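/- Setting. Consider an episodic Markov decision process with horizon $H\ge 1$, state space $\mathcal S$, action space $\mathcal A$, transition kernel $P$, reward kernel $R$, fixed initial state $s_1$, and pairwise disjoint sets of states $\mathcal S_1,\dots,\mathcal S_H\subseteq\mathcal S$, where $s_1\in\mathcal S_1$, a step from a state of $\mathcal S_h$ ($h<H$) leads to $\mathcal S_{h+1}$, and rewards lie in $[-1,1]$ almost surely. Let $\pi:\mathcal S\to\mathcal A$ be a deterministic policy with $Q$-functions $Q^\pi_h(s,a)=\mathbb E[\sum_{h'=h}^H r_{h'}\mid s_h=s,a_h=a,\pi]$, and let $\phi:\mathcal S\times\mathcal A\to\mathbb R^d$ ($d\ge 1$) be a feature map with $\|\phi(s,a)\|_2\le 1$ for all $(s,a)$. Let $\mu_h$ be a probability distribution on $\mathcal S_h\times\mathcal A$ for each $h\in\{1,\dots,H\}$, and let $N\ge 1$. For each $h$ a dataset of $N$ i.i.d. samples $(s_h^i,a_h^i,r_h^i,\overline s_h^i)$ is given, with $(s_h^i,a_h^i)\sim\mu_h$, $r_h^i\sim R(s_h^i,a_h^i)$, $\overline s_h^i\sim P(s_h^i,a_h^i)$. Least-Squares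 Policy Evaluation with parameter $\lambda>0$ sets $\hat V_{H+1}=0$ and, for $h=H,\dots,1$, $$\hat\Lambda_h=\sum_{i=1}^N\phi(s_h^i,a_h^i)\phi(s_h^i,a_h^i)^\top+\lambda I,\qquad \hat\theta_h=\hat\Lambda_h^{-1}\sum_{i=1}^N\phi(s_h^i,a_h^i)\bigl(r_h^i+\hat V_{h+1}(\overline s_h^i)\bigr),$$ $\hat Q_h(s,a)=\phi(s,a)^\top\hat\theta_h$ and $\hat V_h(s)=\hat Q_h(s,\pi(s))$. Let $\Lambda_h=\mathbb E_{(s,a)\sim\mu_h}[\phi(s,a)\phi(s,a)^\top]$, $\overline\Lambda_1=\phi(s_1,\pi(s_1))\phi(s_1,\pi(s_1))^\top$, and, for $1\le h<H$, $\overline\Lambda_{h+1}=\mathbb E_{(s,a)\sim\mu_h,\ \overline s\sim P(s,a)}[\phi(\overline s,\pi(\overline s))\phi(\overline s,\pi(\overline s))^\top]$. Theorem. For every $C>0$ there is a constant $c>0$, depending only on $C$, such that the following holds in every such setting and for every $\delta\in(0,1)$ with $dH/\delta\ge 2$ (this excludes only $d=H=1$, $\delta>1/2$). Suppose that for each $h\in\{1,\dots,H\}$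 there is $\theta_h\in\mathbb R^d$ with $\|\theta_h\|_2\le H\sqrt d$ and $Q^\pi_h(s,a)=\phi(s,a)^\top\theta_h$ for all $(s,a)\in\mathcal S_h\times\mathcal A$, and that for each $h\in\{1,\dots,H\}$ the number $C_h\ge 1$ satisfies $\overline\Lambda_h\preceq C_h\Lambda_h$. Let $\lambda=CH\sqrt{d\log(dH/\delta)\,N}$. Then with probability at least $1-\delta$, $$\bigl(Q^\pi_1(s_1,\pi(s_1))-\hat Q_1(s_1,\pi(s_1))\bigr)^2\le c\cdot\Bigl(\prod_{h=1}^H C_h\Bigr)\cdot dH^5\cdot\sqrt{\frac{d\log(dH/\delta)}{N}}.$$ -/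

import Mathlib

open MeasureTheory ProbabilityTheory
open scoped Matrix

universe u v w

namespace OfflineRL

/-- A finite-horizon Markov decision process on the state space `S` and the action space `A`, with
horizon `H`, fixed initial state `s₁`, transition kernel `P`, reward kernel `R` and disjoint sets of
states `level 1, …, level H`. Rewards lie in `[-1, 1]` almost surely. -/
structure MDP (S A : Type*) [MeasurableSpace S] [MeasurableSpace A] where
  /-- the planning horizon -/
  H : ℕ
  H_pos : 1 ≤ H
  /-- the transition operator -/
  P : Kernel (S × A) S
  markovP : IsMarkovKernel P
  /-- the reward distribution -/
  R : Kernel (S × A) ℝ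
  markovR : IsMarkovKernel R
  /-- the states at each level -/
  level : ℕ → Set S
  measurableSet_level : ∀ h ∈ Set.Icc 1 H, MeasurableSet (level h)
  level_disjoint : (Set.Icc 1 H).PairwiseDisjoint level
  /-- the initial state -/
  s₁ : S
  s₁_mem : s₁ ∈ level 1
  level_step : ∀ h, 1 ≤ h → h < H → ∀ s ∈ level h, ∀ a, ∀ᵐ s' ∂(P (s, a)), s' ∈ level (h + 1)
  reward_bound : ∀ h ∈ Set.Icc 1 H, ∀ s ∈ level h, ∀ a, ∀ᵐ r ∂(R (s, a)), r ∈ Set.Icc (-1 : ℝ) 1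

attribute [instance] MDP.markovP MDP.markovR

section

variable {S A : Type*} [MeasurableSpace S] [MeasurableSpace A]

namespace MDP

/-- The law of the trajectory `(s, a, r), (s', a', r'), …` of `k` steps that starts with the
state-action pair `(s, a)` and in which all later actions are chosen by the deterministic
policy `π`: the reward is drawn from `R (s, a)`, the next state `s'` from `P (s, a)`, and the rest
of the trajectory is a trajectory of `k - 1` steps that starts with `(s', π s')`. -/
noncomputable def trajLaw (M : MDP S A) (π : S → A) :
    (k : ℕ) → Kernel (S × A) (Fin k → (S × A) × ℝ)
  | 0 => Kernel.const _ (Measure.dirac Fin.elim0)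
  | k + 1 =>
    ((Kernel.id ×ₖ M.R) ×ₖ (trajLaw M π k ∘ₖ M.P.map (fun s' => (s', π s')))).map
      (fun p => (Fin.cons p.1 p.2 : Fin (k + 1) → (S × A) × ℝ))

/-- `Q_h^π(s, a) = E[∑_{h' = h}^H r_{h'} | s_h = s, a_h = a, π]`. -/
noncomputable def Q (M : MDP S A) (π : S → A) (h : ℕ) (s : S) (a : A) : ℝ :=
  ∫ τ, ∑ t, (τ t).2 ∂(M.trajLaw π (M.H + 1 - h) (s, a))

theorem measurable_cons {X : Type*} [MeasurableSpace X] (k : ℕ) :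
    Measurable (fun p : X × (Fin k → X) => (Fin.cons p.1 p.2 : Fin (k + 1) → X)) := by
  refine measurable_pi_iff.2 fun i => ?_
  refine Fin.cases ?_ (fun j => ?_) i
  · simpa using measurable_fst
  · simp only [Fin.cons_succ]
    fun_prop

theorem isMarkovKernel_trajLaw (M : MDP S A) {π : S → A} (hπ : Measurable π) (k : ℕ) :
    IsMarkovKernel (M.trajLaw π k) := by
  induction k with
  | zero => unfold trajLaw; infer_instance
  | succ k ih =>
    have h1 : IsMarkovKernel (M.P.map (fun s' => (s', π s'))) :=
      Kernel.IsMarkovKernel.map _ (by fun_prop)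
    unfold trajLaw
    exact Kernel.IsMarkovKernel.map _ (measurable_cons k)

end MDP

/-- A sample `((s, a), (r, s'))`. -/
abbrev Sample (S A : Type*) := (S × A) × (ℝ × S)

/-- The law of a sample: `(s, a) ∼ μ`, `r ∼ R (s, a)` and `s' ∼ P (s, a)`. -/
noncomputable def sampleLaw (M : MDP S A) (μ : Measure (S × A)) : Measure (Sample S A) :=
  μ ⊗ₘ (M.R ×ₖ M.P)

variable {d N : ℕ}

/-- `∑_i φ(s_i, a_i) φ(s_i, a_i)ᵀ + lam I`, the regularized empirical covariance of a dataset. -/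
noncomputable def empCov (φ : S → A → EuclideanSpace ℝ (Fin d)) (lam : ℝ)
    (D : Fin N → Sample S A) : Matrix (Fin d) (Fin d) ℝ :=
  ∑ i, Matrix.vecMulVec (φ (D i).1.1 (D i).1.2) (φ (D i).1.1 (D i).1.2) + lam • 1

/-- The estimates `θ̂_h` of Least-Squares Policy Evaluation, computed backwards from level `H`, where
`D h` is the dataset of level `h`. They are `0` above level `H`, so that `V̂_{H + 1} = 0`. -/
noncomputable def thetaHat (φ : S → A → EuclideanSpace ℝ (Fin d)) (π : S → A) (lam : ℝ) (H : ℕ)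
    (D : ℕ → Fin N → Sample S A) (h : ℕ) : EuclideanSpace ℝ (Fin d) :=
  if h ≤ H then
    WithLp.toLp 2 ((empCov φ lam (D h))⁻¹ *ᵥ
      (∑ i, ((D h i).2.1
          + inner ℝ (φ (D h i).2.2 (π (D h i).2.2)) (thetaHat φ π lam H D (h + 1))) •
        φ (D h i).1.1 (D h i).1.2).ofLp)
  else 0
termination_by H + 1 - h

/-- The estimate `Q̂_h(s, a) = φ(s, a)ᵀ θ̂_h` of Least-Squares Policy Evaluation. -/
noncomputable def QHat (φ : S → A → EuclideanSpace ℝ (Fin d)) (π : S → A) (lam : ℝ) (H : ℕ)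
    (D : ℕ → Fin N → Sample S A) (h : ℕ) (s : S) (a : A) : ℝ :=
  inner ℝ (φ s a) (thetaHat φ π lam H D h)

/-- `Λ = E_{(s, a) ∼ μ} [φ(s, a) φ(s, a)ᵀ]`. -/
noncomputable def featCov (φ : S → A → EuclideanSpace ℝ (Fin d)) (μ : Measure (S × A)) :
    Matrix (Fin d) (Fin d) ℝ :=
  Matrix.of fun i j => ∫ p, φ p.1 p.2 i * φ p.1 p.2 j ∂μ

/-- The covariance of the one-step lookahead distribution: at level `1` it is
`φ(s₁, π(s₁)) φ(s₁, π(s₁))ᵀ`, and at level `h + 1` with `h ≥ 1` it is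
`E [φ(s', π(s')) φ(s', π(s'))ᵀ]` for `(s, a) ∼ μ h` and `s' ∼ P (s, a)`. -/
noncomputable def lookaheadCov (M : MDP S A) (φ : S → A → EuclideanSpace ℝ (Fin d)) (π : S → A)
    (μ : ℕ → Measure (S × A)) (h : ℕ) : Matrix (Fin d) (Fin d) ℝ :=
  if h = 1 then Matrix.vecMulVec (φ M.s₁ (π M.s₁)) (φ M.s₁ (π M.s₁))
  else Matrix.of fun i j =>
    ∫ p, ∫ s', φ s' (π s') i * φ s' (π s') j ∂(M.P p) ∂(μ (h - 1))

end

end OfflineRL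

/-!
By the Bellman equation the regression targets of each level have mean zero noise around the true
parameter `θ h`. A Hilbert space valued Hoeffding inequality, whose dimension-free moment bound is
`E cosh (t ‖x + Y‖) ≤ cosh (t ‖x‖) cosh (t b)` for centred `Y` with `‖Y‖ ≤ b`, makes the sum of the
noise vectors small; applied to the centred tensors `f ⊗ f` it makes the quadratic forms of all
empirical covariances uniformly close to their expectations.

Let `e h` be the error `θ h - θ' h` of the estimate `θ' h` in the norm of the regularized empirical
covariance of level `h`. Ridge regression bounds `e h` by bias, noise, and the error of the next
level measured in the empirical covariance of the successor features. This is a sample version of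
the lookahead covariance, so by concentration and bounded shift that last term is at most
`√((1 + O(√N / λ)) C_{h+1}) * e (h + 1)`. Unrolling from `H` down to `1` multiplies the shift
coefficients. With `λ` of order `H √N` the additional factors `1 + O(√N / λ)` stay bounded
over the `H` levels and the noise is dominated by the bias.
-/

namespace OfflineRL

section Cosh

theorem convexOn_cosh_sqrt : ConvexOn ℝ (Set.Ici 0) fun x : ℝ => Real.cosh √x := by
  have hasSum {x : ℝ} (hx : 0 ≤ x) :
      HasSum (fun n : ℕ => x ^ n / ((2 * n).factorial : ℝ)) (Real.cosh √x) := by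
    simpa only [pow_mul, Real.sq_sqrt hx] using Real.hasSum_cosh √x
  refine ⟨convex_Ici 0, fun x hx y hy p q hp hq hpq => ?_⟩
  have hxy : 0 ≤ p • x + q • y := (convex_Ici (0 : ℝ)) hx hy hp hq hpq
  refine hasSum_le (fun n => ?_) (hasSum hxy)
    (((hasSum hx).mul_left p).add ((hasSum hy).mul_left q))
  rw [← mul_div_assoc, ← mul_div_assoc, ← add_div]
  gcongr
  exact (convexOn_pow n).2 hx hy hp hq hpq

variable {E : Type*} [NormedAddCommGroup E]

theorem cosh_mul_norm_le_of_norm_le {x : E} {b : ℝ} (h : ‖x‖ ≤ b) (t : ℝ) :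
    Real.cosh (t * ‖x‖) ≤ Real.cosh (t * b) := by
  rw [Real.cosh_le_cosh, abs_mul, abs_mul, abs_norm]
  gcongr
  exact h.trans (le_abs_self b)

variable [InnerProductSpace ℝ E]

/-- The vector of signed length `sinh (t * ‖x‖)` in the direction of `x`, and `0` for `x = 0`.
Up to the factor `t` it is the gradient of `x ↦ cosh (t * ‖x‖)`; it is the coefficient of the linear
term in the expansion `cosh_norm_add_le`. -/
noncomputable def sinhRadial (t : ℝ) (x : E) : E :=
  (Real.sinh (t * ‖x‖) / ‖x‖) • x

theorem norm_sinhRadial_le (t : ℝ) (x : E) : ‖sinhRadial t x‖ ≤ Real.cosh (t * ‖x‖) := by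
  calc ‖sinhRadial t x‖ = |Real.sinh (t * ‖x‖)| * (‖x‖ / ‖x‖) := by
        rw [sinhRadial, norm_smul, Real.norm_eq_abs, abs_div, abs_norm]; ring
    _ ≤ |Real.sinh (t * ‖x‖)| := mul_le_of_le_one_right (abs_nonneg _) (div_self_le_one _)
    _ ≤ Real.cosh (t * ‖x‖) := by
        rw [Real.abs_sinh, ← Real.cosh_abs]
        exact (Real.sinh_lt_cosh _).le

/-- `‖x + y‖ ^ 2` is at most the convex combination with weights `(1 ± s) / 2` of the squares of
`‖x‖ ± b`, where `s` is the normalized inner product of `x` and `y`; then `cosh ∘ √` is convex. -/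
theorem cosh_norm_add_le (t : ℝ) {b : ℝ} {x y : E} (hy : ‖y‖ ≤ b) :
    Real.cosh (t * ‖x + y‖) ≤ Real.cosh (t * ‖x‖) * Real.cosh (t * b)
      + Real.sinh (t * b) / b * inner ℝ (sinhRadial t x) y := by
  have hb : 0 ≤ b := (norm_nonneg y).trans hy
  have hxy : |inner ℝ x y| ≤ ‖x‖ * b := (abs_real_inner_le_norm x y).trans (by gcongr)
  set s := inner ℝ x y / (‖x‖ * b) with hs
  have hs1 : |s| ≤ 1 := by
    rw [hs, abs_div, abs_of_nonneg (by positivity : 0 ≤ ‖x‖ * b)]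
    exact div_le_one_of_le₀ hxy (by positivity)
  have hinner : inner ℝ x y = ‖x‖ * b * s := by
    rcases eq_or_ne (‖x‖ * b) 0 with h0 | h0
    · rw [h0, zero_mul]
      exact abs_nonpos_iff.1 (hxy.trans_eq h0)
    · rw [hs, mul_div_cancel₀ _ h0]
  have hp : 0 ≤ (1 + s) / 2 := by linarith [(abs_le.1 hs1).1]
  have hq : 0 ≤ (1 - s) / 2 := by linarith [(abs_le.1 hs1).2]
  have hsq : (t * ‖x + y‖) ^ 2 ≤
      (1 + s) / 2 * (t * ‖x‖ + t * b) ^ 2 + (1 - s) / 2 * (t * ‖x‖ - t * b) ^ 2 := by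
    calc (t * ‖x + y‖) ^ 2 = t ^ 2 * (‖x‖ ^ 2 + 2 * (‖x‖ * b * s) + ‖y‖ ^ 2) := by
          rw [mul_pow, norm_add_sq_real, hinner]
      _ ≤ t ^ 2 * (‖x‖ ^ 2 + 2 * (‖x‖ * b * s) + b ^ 2) := by gcongr
      _ = _ := by ring
  have hconv := convexOn_cosh_sqrt.2 (sq_nonneg (t * ‖x‖ + t * b)) (sq_nonneg (t * ‖x‖ - t * b))
    hp hq (by ring)
  simp only [Real.sqrt_sq_eq_abs, Real.cosh_abs, smul_eq_mul] at hconv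
  calc Real.cosh (t * ‖x + y‖)
      ≤ Real.cosh √((1 + s) / 2 * (t * ‖x‖ + t * b) ^ 2
          + (1 - s) / 2 * (t * ‖x‖ - t * b) ^ 2) := by
        rw [Real.cosh_le_cosh, abs_of_nonneg (Real.sqrt_nonneg _)]
        exact Real.abs_le_sqrt hsq
    _ ≤ (1 + s) / 2 * Real.cosh (t * ‖x‖ + t * b) + (1 - s) / 2 * Real.cosh (t * ‖x‖ - t * b) :=
        hconv
    _ = Real.cosh (t * ‖x‖) * Real.cosh (t * b)
          + Real.sinh (t * ‖x‖) * Real.sinh (t * b) * s := by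
        rw [Real.cosh_add, Real.cosh_sub]; ring
    _ = _ := by rw [sinhRadial, real_inner_smul_left, hs]; ring

end Cosh

section Hoeffding

variable {E : Type*} [NormedAddCommGroup E] {Ω : Type*} [MeasurableSpace Ω] {Pr : Measure Ω}

theorem ae_norm_sum_le {ι : Type*} {X : ι → Ω → E} {b : ℝ} (hXb : ∀ i, ∀ᵐ ω ∂Pr, ‖X i ω‖ ≤ b)
    (s : Finset ι) : ∀ᵐ ω ∂Pr, ‖∑ i ∈ s, X i ω‖ ≤ s.card * b := by
  filter_upwards [(ae_ball_iff s.countable_toSet).2 fun i _ => hXb i] with ω hω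
  simpa using norm_sum_le_of_le s hω

variable [MeasurableSpace E] [BorelSpace E] [IsProbabilityMeasure Pr]

theorem integrable_cosh_mul_norm {X : Ω → E} (hX : AEMeasurable X Pr) {b : ℝ}
    (hXb : ∀ᵐ ω ∂Pr, ‖X ω‖ ≤ b) (t : ℝ) : Integrable (fun ω => Real.cosh (t * ‖X ω‖)) Pr := by
  refine Integrable.of_bound (AEMeasurable.aestronglyMeasurable (by fun_prop))
    (Real.cosh (t * b)) ?_
  filter_upwards [hXb] with ω hω
  rw [Real.norm_eq_abs, abs_of_pos (Real.cosh_pos _)]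
  exact cosh_mul_norm_le_of_norm_le hω t

variable [InnerProductSpace ℝ E] [SecondCountableTopology E]

theorem measurable_sinhRadial (t : ℝ) : Measurable (sinhRadial t : E → E) := by
  unfold sinhRadial
  fun_prop

variable [CompleteSpace E]

theorem integral_cosh_norm_add_le {X Y : Ω → E} (hXY : X ⟂ᵢ[Pr] Y) (hX : AEMeasurable X Pr)
    (hY : AEMeasurable Y Pr) {b t : ℝ} (hint : Integrable (fun ω => Real.cosh (t * ‖X ω‖)) Pr)
    (hYb : ∀ᵐ ω ∂Pr, ‖Y ω‖ ≤ b) (hY0 : ∫ ω, Y ω ∂Pr = 0) :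
    ∫ ω, Real.cosh (t * ‖X ω + Y ω‖) ∂Pr ≤
      (∫ ω, Real.cosh (t * ‖X ω‖) ∂Pr) * Real.cosh (t * b) := by
  have hG : Integrable (fun ω => sinhRadial t (X ω)) Pr :=
    hint.mono' ((measurable_sinhRadial t).comp_aemeasurable hX).aestronglyMeasurable
      (ae_of_all _ fun ω => norm_sinhRadial_le t (X ω))
  have hYint : Integrable Y Pr := Integrable.of_bound hY.aestronglyMeasurable b hYb
  have hGY : (fun ω => sinhRadial t (X ω)) ⟂ᵢ[Pr] Y :=
    hXY.comp (measurable_sinhRadial t) measurable_id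
  have hinner : Integrable (fun ω => inner ℝ (sinhRadial t (X ω)) (Y ω)) Pr :=
    hGY.integrable_bilin hG hYint (innerSL ℝ)
  have hinner0 : ∫ ω, inner ℝ (sinhRadial t (X ω)) (Y ω) ∂Pr = 0 := by
    refine (hGY.integral_bilin hG hYint (innerSL ℝ)).trans ?_
    rw [hY0, map_zero]
  calc ∫ ω, Real.cosh (t * ‖X ω + Y ω‖) ∂Pr
      ≤ ∫ ω, (Real.cosh (t * ‖X ω‖) * Real.cosh (t * b)
          + Real.sinh (t * b) / b * inner ℝ (sinhRadial t (X ω)) (Y ω)) ∂Pr := by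
        refine integral_mono_of_nonneg (ae_of_all _ fun ω => (Real.cosh_pos _).le)
          ((hint.mul_const _).add (hinner.const_mul _)) ?_
        filter_upwards [hYb] with ω hω using cosh_norm_add_le t hω
    _ = (∫ ω, Real.cosh (t * ‖X ω‖) ∂Pr) * Real.cosh (t * b) := by
        rw [integral_add (hint.mul_const _) (hinner.const_mul _), integral_const_mul, hinner0,
          mul_zero, add_zero, integral_mul_const]

variable {ι : Type*} {X : ι → Ω → E} {b : ℝ}

theorem integral_cosh_norm_sum_le (hind : iIndepFun X Pr) (hX : ∀ i, AEMeasurable (X i) Pr)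
    (hXb : ∀ i, ∀ᵐ ω ∂Pr, ‖X i ω‖ ≤ b) (hX0 : ∀ i, ∫ ω, X i ω ∂Pr = 0) (t : ℝ) (s : Finset ι) :
    ∫ ω, Real.cosh (t * ‖∑ i ∈ s, X i ω‖) ∂Pr ≤ Real.cosh (t * b) ^ s.card := by
  classical
  induction s using Finset.induction_on with
  | empty => simp
  | insert j s hj ih =>
    have hsum : AEMeasurable (fun ω => ∑ i ∈ s, X i ω) Pr := by fun_prop
    have hindep : (fun ω => ∑ i ∈ s, X i ω) ⟂ᵢ[Pr] X j := by
      have h := hind.indepFun_finsetSum_of_notMem₀ hX hj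
      rwa [Finset.sum_fn] at h
    have hint := integrable_cosh_mul_norm hsum (ae_norm_sum_le hXb s) t
    simp_rw [Finset.sum_insert hj, add_comm (X j _)]
    rw [Finset.card_insert_of_notMem hj, pow_succ]
    refine (integral_cosh_norm_add_le hindep hsum (hX j) hint (hXb j) (hX0 j)).trans ?_
    exact mul_le_mul_of_nonneg_right ih (Real.cosh_pos _).le

/-- Markov's inequality for `cosh (t * ‖∑ i, X i‖)`, with the optimal `t = √(2 * n * x) / (b * n)`
for a sum of `n` terms. -/
theorem measureReal_le_norm_sum_le [Fintype ι] [Nonempty ι] (hind : iIndepFun X Pr)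
    (hX : ∀ i, AEMeasurable (X i) Pr) (hb : 0 < b) (hXb : ∀ i, ∀ᵐ ω ∂Pr, ‖X i ω‖ ≤ b)
    (hX0 : ∀ i, ∫ ω, X i ω ∂Pr = 0) {x : ℝ} (hx : 0 ≤ x) :
    Pr.real {ω | b * √(2 * Fintype.card ι * x) ≤ ‖∑ i, X i ω‖} ≤ 2 * Real.exp (-x) := by
  set n : ℝ := (Fintype.card ι : ℝ) with hn
  have hn0 : 0 < n := Nat.cast_pos.2 Fintype.card_pos
  set q := √(2 * n * x)
  have hq : q ^ 2 = 2 * n * x := Real.sq_sqrt (by positivity)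
  set t := q / (b * n) with ht
  have hint : Integrable (fun ω => Real.cosh (t * ‖∑ i, X i ω‖)) Pr :=
    integrable_cosh_mul_norm (by fun_prop) (ae_norm_sum_le hXb Finset.univ) t
  have hmoment : ∫ ω, Real.cosh (t * ‖∑ i, X i ω‖) ∂Pr ≤ Real.exp x := by
    calc _ ≤ Real.cosh (t * b) ^ Fintype.card ι :=
          integral_cosh_norm_sum_le hind hX hXb hX0 t Finset.univ
      _ ≤ Real.exp ((t * b) ^ 2 / 2) ^ Fintype.card ι := by
          gcongr; exact Real.cosh_le_exp_half_sq _
      _ = Real.exp x := by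
          rw [← Real.exp_nat_mul, ← hn, ht]
          congr 1
          field_simp
          linear_combination hq
  have hsub : {ω | b * q ≤ ‖∑ i, X i ω‖} ⊆
      {ω | Real.exp (2 * x) / 2 ≤ Real.cosh (t * ‖∑ i, X i ω‖)} := by
    intro ω hω
    have htx : 2 * x ≤ t * ‖∑ i, X i ω‖ := by
      calc 2 * x = t * (b * q) := by rw [ht]; field_simp; linear_combination -hq
        _ ≤ _ := by gcongr; exact hω
    rw [Set.mem_ofPred_eq, Real.cosh_eq]
    linarith [Real.exp_le_exp.2 htx, Real.exp_pos (-(t * ‖∑ i, X i ω‖))]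
  have hmarkov := (mul_meas_ge_le_integral_of_nonneg (ae_of_all _ fun ω => (Real.cosh_pos _).le)
    hint (Real.exp (2 * x) / 2)).trans hmoment
  calc Pr.real {ω | b * q ≤ ‖∑ i, X i ω‖}
      ≤ Pr.real {ω | Real.exp (2 * x) / 2 ≤ Real.cosh (t * ‖∑ i, X i ω‖)} := measureReal_mono hsub
    _ ≤ Real.exp x / (Real.exp (2 * x) / 2) := (le_div_iff₀' (by positivity)).2 hmarkov
    _ = 2 * Real.exp (-x) := by
        rw [div_div_eq_mul_div, mul_comm, mul_div_assoc, ← Real.exp_sub]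
        ring_nf

end Hoeffding

section Deviation

variable {E : Type*} [NormedAddCommGroup E] [InnerProductSpace ℝ E]

/-- The quadratic form `v ↦ ∑ i, ⟪f i, v⟫ ^ 2` of the unnormalized, unregularized empirical
covariance of the features `f`. -/
noncomputable def sampleForm {ι : Type*} [Fintype ι] (f : ι → E) (v : E) : ℝ :=
  ∑ i, inner ℝ (f i) v ^ 2

/-- The quadratic form `v ↦ E ⟪f y, v⟫ ^ 2` of the covariance of the feature `f y` for `y ∼ ν`. -/
noncomputable def populationForm {Y : Type*} [MeasurableSpace Y] (ν : Measure Y) (f : Y → E)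
    (v : E) : ℝ :=
  ∫ y, inner ℝ (f y) v ^ 2 ∂ν

theorem sampleForm_nonneg {ι : Type*} [Fintype ι] (f : ι → E) (v : E) : 0 ≤ sampleForm f v :=
  Finset.sum_nonneg fun _ _ => sq_nonneg _

variable {ι : Type*} [Fintype ι] [Nonempty ι] {Y Ω : Type*} [MeasurableSpace Y]
  [MeasurableSpace Ω] {Pr : Measure Ω} {ν : Measure Y} {D : ι → Ω → Y} [IsProbabilityMeasure Pr]

theorem measureReal_le_norm_sum_comp_le [CompleteSpace E] [SecondCountableTopology E]
    [MeasurableSpace E] [BorelSpace E] (hD : ∀ i, HasLaw (D i) ν Pr) (hind : iIndepFun D Pr)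
    {g : Y → E} (hg : Measurable g) {b : ℝ} (hb : 0 < b) (hgb : ∀ᵐ y ∂ν, ‖g y‖ ≤ b)
    (hg0 : ∫ y, g y ∂ν = 0) {x : ℝ} (hx : 0 ≤ x) :
    Pr.real {ω | b * √(2 * Fintype.card ι * x) ≤ ‖∑ i, g (D i ω)‖} ≤ 2 * Real.exp (-x) :=
  measureReal_le_norm_sum_le (X := fun i ω => g (D i ω)) (hind.comp _ fun _ => hg)
    (fun i => hg.comp_aemeasurable (hD i).aemeasurable) hb
    (fun i => ae_of_ae_map (hD i).aemeasurable ((hD i).map_eq.symm ▸ hgb))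
    (fun i => ((hD i).integral_comp hg.aestronglyMeasurable).trans hg0) hx

open scoped TensorProduct

/-- `⟪u, v⟫ ^ 2` is the inner product of `u ⊗ u` and `v ⊗ v`, so the deviation of all the quadratic
forms at once is controlled by the norm of one centred sum in the tensor square. -/
theorem measureReal_exists_lt_abs_sampleForm_sub_le [FiniteDimensional ℝ E] [MeasurableSpace E]
    [BorelSpace E] [IsProbabilityMeasure ν] (hD : ∀ i, HasLaw (D i) ν Pr) (hind : iIndepFun D Pr)
    {f : Y → E} (hf : Measurable f) (hf1 : ∀ y, ‖f y‖ ≤ 1) {x : ℝ} (hx : 0 ≤ x) :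
    Pr.real {ω | ∃ v, 2 * √(2 * Fintype.card ι * x) * ‖v‖ ^ 2 <
        |sampleForm (fun i => f (D i ω)) v - Fintype.card ι * populationForm ν f v|} ≤
      2 * Real.exp (-x) := by
  borelize (E ⊗[ℝ] E)
  let F : Y → E ⊗[ℝ] E := fun y => f y ⊗ₜ f y
  have hF : Measurable F := by
    have : Continuous fun v : E => v ⊗ₜ[ℝ] v := by fun_prop
    exact this.measurable.comp hf
  have hF1 (y : Y) : ‖F y‖ ≤ 1 := by
    rw [TensorProduct.norm_tmul]
    exact mul_le_one₀ (hf1 y) (norm_nonneg _) (hf1 y)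
  let T (v : E) : E ⊗[ℝ] E →L[ℝ] ℝ := innerSL ℝ (v ⊗ₜ v)
  have hTF (v : E) (y : Y) : T v (F y) = inner ℝ (f y) v ^ 2 := by
    rw [real_inner_comm, sq]
    exact TensorProduct.inner_tmul ..
  have hT (v : E) : ‖T v‖ = ‖v‖ ^ 2 := by
    rw [innerSL_apply_norm, TensorProduct.norm_tmul, sq]
  have hint : Integrable F ν :=
    Integrable.of_bound hF.aestronglyMeasurable 1 (ae_of_all _ hF1)
  set m := ∫ y, F y ∂ν
  have hm1 : ‖m‖ ≤ 1 := by
    simpa using norm_integral_le_of_norm_le_const (μ := ν) (ae_of_all _ hF1)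
  have hm (v : E) : T v m = populationForm ν f v := by
    rw [← (T v).integral_comp_comm hint]
    exact integral_congr_ae (ae_of_all _ (hTF v))
  have hmain := measureReal_le_norm_sum_comp_le hD hind (hF.sub_const m) two_pos
    (ae_of_all _ fun y => (norm_sub_le _ _).trans (by linarith [hF1 y]))
    (by rw [integral_sub hint (integrable_const _)]; simp [m]) hx
  refine (measureReal_mono ?_).trans hmain
  rintro ω ⟨v, hv⟩
  have hdev : sampleForm (fun i => f (D i ω)) v - Fintype.card ι * populationForm ν f v
      = T v (∑ i, (F (D i ω) - m)) := by
    simp [hTF, hm, sampleForm]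
  rw [hdev] at hv
  have hle := hv.trans_le ((T v).le_opNorm _)
  rw [hT, mul_comm (‖v‖ ^ 2)] at hle
  exact (lt_of_mul_lt_mul_right hle (sq_nonneg _)).le

end Deviation

section Bellman

variable {S A : Type*} [MeasurableSpace S] [MeasurableSpace A]

namespace MDP

variable (M : MDP S A) {π : S → A} (hπ : Measurable π) {k h : ℕ}

/-- The law of the trajectory of `k` steps that starts in a given state and follows `π`. -/
noncomputable def stateTrajLaw (k : ℕ) : Kernel S (Fin k → (S × A) × ℝ) :=
  (M.trajLaw π k).comap (fun s' => (s', π s')) (by fun_prop)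

theorem isMarkovKernel_stateTrajLaw (k : ℕ) : IsMarkovKernel (M.stateTrajLaw hπ k) := by
  have := M.isMarkovKernel_trajLaw hπ k
  unfold stateTrajLaw
  infer_instance

theorem trajLaw_succ_apply (k : ℕ) (p : S × A) :
    M.trajLaw π (k + 1) p =
      (((Measure.dirac p).prod (M.R p)).prod ((M.P p).bind (M.stateTrajLaw hπ k))).map
      (fun q => (Fin.cons q.1 q.2 : Fin (k + 1) → (S × A) × ℝ)) := by
  have := M.isMarkovKernel_trajLaw hπ k
  have : IsMarkovKernel (M.P.map (fun s' => (s', π s'))) :=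
    Kernel.IsMarkovKernel.map _ (by fun_prop)
  rw [trajLaw, Kernel.map_apply _ (measurable_cons k), Kernel.prod_apply, Kernel.prod_apply,
    Kernel.id_apply, Kernel.comp_apply, Kernel.map_apply _ (by fun_prop)]
  congr 2
  rw [Measure.bind, Measure.map_map (Kernel.measurable _) (by fun_prop)]
  rfl

theorem measurableSet_forall_reward_mem {s : Set ℝ} (hs : MeasurableSet s) (k : ℕ) :
    MeasurableSet {τ : Fin k → (S × A) × ℝ | ∀ t, (τ t).2 ∈ s} := by
  measurability

theorem ae_trajLaw_succ_reward {p : S × A} {s : Set ℝ} (hs : MeasurableSet s)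
    (hR : ∀ᵐ r ∂(M.R p), r ∈ s)
    (hP : ∀ᵐ τ ∂((M.P p).bind (M.stateTrajLaw hπ k)), ∀ t, (τ t).2 ∈ s) :
    ∀ᵐ τ ∂(M.trajLaw π (k + 1) p), ∀ t, (τ t).2 ∈ s := by
  have := M.isMarkovKernel_stateTrajLaw hπ k
  rw [trajLaw_succ_apply M hπ, ae_map_iff (measurable_cons k).aemeasurable
    (measurableSet_forall_reward_mem hs _)]
  filter_upwards [Measure.quasiMeasurePreserving_fst.ae (Measure.quasiMeasurePreserving_snd.ae hR),
    Measure.quasiMeasurePreserving_snd.ae hP] with q hq1 hq2 t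
  cases t using Fin.cases with
  | zero => simpa using hq1
  | succ t => simpa using hq2 t

theorem ae_bind_stateTrajLaw_reward (h1 : 1 ≤ h) (hk : h + k = M.H) {s : S} (hs : s ∈ M.level h)
    (a : A) (hnext : ∀ s' ∈ M.level (h + 1), ∀ a',
      ∀ᵐ τ ∂(M.trajLaw π k (s', a')), ∀ t, (τ t).2 ∈ Set.Icc (-1 : ℝ) 1) :
    ∀ᵐ τ ∂((M.P (s, a)).bind (M.stateTrajLaw hπ k)), ∀ t, (τ t).2 ∈ Set.Icc (-1 : ℝ) 1 := by
  rcases k with _ | k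
  · exact ae_of_all _ fun τ t => t.elim0
  · refine Measure.ae_comp_of_ae_ae (measurableSet_forall_reward_mem measurableSet_Icc _) ?_
    filter_upwards [M.level_step h h1 (by lia) s hs a] with s' hs'
    exact hnext s' hs' (π s')

include hπ in
theorem ae_trajLaw_reward (h1 : 1 ≤ h) (hk : h + k = M.H + 1) {s : S} (hs : s ∈ M.level h)
    (a : A) : ∀ᵐ τ ∂(M.trajLaw π k (s, a)), ∀ t, (τ t).2 ∈ Set.Icc (-1 : ℝ) 1 := by
  induction k generalizing h s a with
  | zero => exact ae_of_all _ fun τ t => t.elim0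
  | succ k ih =>
    exact M.ae_trajLaw_succ_reward hπ measurableSet_Icc
      (M.reward_bound h ⟨h1, by lia⟩ s hs a)
      (M.ae_bind_stateTrajLaw_reward hπ h1 (by lia) hs a fun s' hs' a' =>
        ih (by lia) (by lia) hs' a')

theorem integrable_sum_reward {μ : Measure (Fin k → (S × A) × ℝ)} [IsFiniteMeasure μ]
    (hμ : ∀ᵐ τ ∂μ, ∀ t, (τ t).2 ∈ Set.Icc (-1 : ℝ) 1) : Integrable (fun τ => ∑ t, (τ t).2) μ := by
  refine integrable_finsetSum _ fun t _ => Integrable.of_bound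
    (Measurable.aestronglyMeasurable (by fun_prop)) 1 ?_
  filter_upwards [hμ] with τ hτ using abs_le.2 (hτ t)

theorem integrable_reward (hh : h ∈ Set.Icc 1 M.H) {s : S} (hs : s ∈ M.level h) (a : A) :
    Integrable id (M.R (s, a)) := by
  refine Integrable.of_bound measurable_id.aestronglyMeasurable 1 ?_
  filter_upwards [M.reward_bound h hh s hs a] with r hr using abs_le.2 hr

theorem integral_trajLaw_succ {p : S × A} (hR : Integrable id (M.R p))
    (hP : Integrable (fun τ => ∑ t, (τ t).2) ((M.P p).bind (M.stateTrajLaw hπ k))) :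
    ∫ τ, ∑ t, (τ t).2 ∂(M.trajLaw π (k + 1) p) =
      ∫ r, r ∂(M.R p) + ∫ s', ∫ τ, ∑ t, (τ t).2 ∂(M.trajLaw π k (s', π s')) ∂(M.P p) := by
  have := M.isMarkovKernel_stateTrajLaw hπ k
  have hm {μ : Measure (Fin (k + 1) → (S × A) × ℝ)} :
      AEStronglyMeasurable (fun τ : Fin (k + 1) → (S × A) × ℝ => ∑ t, (τ t).2) μ :=
    Measurable.aestronglyMeasurable (by fun_prop)
  have hR' : Integrable (fun q : (S × A) × ℝ => q.2) ((Measure.dirac p).prod (M.R p)) :=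
    hR.comp_snd _
  rw [trajLaw_succ_apply M hπ, integral_map (measurable_cons k).aemeasurable hm]
  simp only [Fin.sum_univ_succ, Fin.cons_zero, Fin.cons_succ]
  rw [integral_add (hR'.comp_fst _) (hP.comp_snd _),
    integral_fun_fst (f := fun q : (S × A) × ℝ => q.2), integral_fun_snd (f := fun r : ℝ => r),
    integral_fun_snd (f := fun τ : Fin k → (S × A) × ℝ => ∑ t, (τ t).2)]
  simp only [probReal_univ, one_smul]
  congr 1
  rw [Measure.comp_eq_comp_const_apply] at hP ⊢
  rw [Kernel.integral_comp hP, Kernel.const_apply]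
  rfl

theorem Q_of_add_eq (π : S → A) (hk : h + k = M.H + 1) (s : S) (a : A) :
    M.Q π h s a = ∫ τ, ∑ t, (τ t).2 ∂(M.trajLaw π k (s, a)) := by
  obtain rfl : k = M.H + 1 - h := by lia
  rfl

include hπ in
theorem Q_eq_integral_add (hh : h ∈ Set.Icc 1 M.H) {s : S} (hs : s ∈ M.level h) (a : A) :
    M.Q π h s a = ∫ r, r ∂(M.R (s, a)) + ∫ s', M.Q π (h + 1) s' (π s') ∂(M.P (s, a)) := by
  obtain ⟨k, hk⟩ := Nat.exists_eq_add_of_le hh.2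
  have := M.isMarkovKernel_stateTrajLaw hπ k
  have htail := integrable_sum_reward (M.ae_bind_stateTrajLaw_reward hπ hh.1 hk.symm hs a
    fun s' hs' a' => M.ae_trajLaw_reward hπ (by lia) (by lia) hs' a')
  simp only [M.Q_of_add_eq π (h := h) (k := k + 1) (by lia),
    M.Q_of_add_eq π (h := h + 1) (k := k) (by lia)]
  exact M.integral_trajLaw_succ hπ (M.integrable_reward hh hs a) htail

theorem Q_eq_zero (π : S → A) (hh : M.H < h) (s : S) (a : A) : M.Q π h s a = 0 := by
  have h0 : M.H + 1 - h = 0 := by lia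
  rw [Q, h0]
  simp

end MDP

end Bellman

section RidgeRegression

variable {E : Type*} [NormedAddCommGroup E] [InnerProductSpace ℝ E] {ι : Type*} [Fintype ι]

/-- The quadratic form `v ↦ ∑ i, ⟪f i, v⟫ ^ 2 + lam * ‖v‖ ^ 2` of the regularized empirical
covariance of the features `f`, in which the error of ridge regression is measured. -/
noncomputable def ridgeForm (f : ι → E) (lam : ℝ) (v : E) : ℝ :=
  sampleForm f v + lam * ‖v‖ ^ 2

theorem sqrt_sampleForm_le_sqrt_ridgeForm (f : ι → E) {lam : ℝ} (hlam : 0 ≤ lam) (v : E) :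
    √(sampleForm f v) ≤ √(ridgeForm f lam v) :=
  Real.sqrt_le_sqrt (le_add_of_nonneg_right (by positivity))

theorem sqrt_mul_norm_le_sqrt_ridgeForm (f : ι → E) {lam : ℝ} (hlam : 0 ≤ lam) (v : E) :
    √lam * ‖v‖ ≤ √(ridgeForm f lam v) := by
  refine Real.le_sqrt_of_sq_le ?_
  rw [mul_pow, Real.sq_sqrt hlam]
  exact le_add_of_nonneg_left (sampleForm_nonneg f v)

theorem ridgeForm_nonneg (f : ι → E) {lam : ℝ} (hlam : 0 ≤ lam) (v : E) : 0 ≤ ridgeForm f lam v :=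
  add_nonneg (sampleForm_nonneg f v) (by positivity)

/-- The normal equation `h` is that of a ridge regression estimate `θ'` whose targets deviate from
those of the true parameter `θ` by the noise `n` and the misspecification `x`. -/
theorem ridgeForm_sub_eq {f : ι → E} {lam : ℝ} {θ θ' : E} {n x : ι → ℝ}
    (h : ∑ i, inner ℝ (f i) θ' • f i + lam • θ' = ∑ i, (n i + inner ℝ (f i) θ - x i) • f i) :
    ridgeForm f lam (θ - θ') = lam * inner ℝ θ (θ - θ') - inner ℝ (∑ i, n i • f i) (θ - θ')
      + ∑ i, x i * inner ℝ (f i) (θ - θ') := by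
  set z := θ - θ' with hz
  have hform : sampleForm f z =
      ∑ i, inner ℝ (f i) θ * inner ℝ (f i) z - ∑ i, inner ℝ (f i) θ' * inner ℝ (f i) z := by
    simp only [sampleForm, ← Finset.sum_sub_distrib, ← sub_mul, ← inner_sub_right, ← hz, sq]
  have hnorm : ‖z‖ ^ 2 = inner ℝ θ z - inner ℝ θ' z := by
    rw [← inner_sub_left, ← hz, real_inner_self_eq_norm_sq]
  have hz_inner := congrArg (fun y => inner ℝ y z) h
  simp only [inner_add_left, sum_inner, real_inner_smul_left, add_mul, sub_mul,
    Finset.sum_add_distrib, Finset.sum_sub_distrib] at hz_inner ⊢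
  rw [ridgeForm, hform, hnorm]
  linear_combination -hz_inner

theorem sqrt_ridgeForm_sub_le {f : ι → E} {lam : ℝ} (hlam : 0 < lam) {θ θ' : E} {n x : ι → ℝ}
    (h : ∑ i, inner ℝ (f i) θ' • f i + lam • θ' = ∑ i, (n i + inner ℝ (f i) θ - x i) • f i) :
    √(ridgeForm f lam (θ - θ')) ≤
      √lam * ‖θ‖ + ‖∑ i, n i • f i‖ / √lam + √(∑ i, x i ^ 2) := by
  have hid := ridgeForm_sub_eq h
  have hnorm := sqrt_mul_norm_le_sqrt_ridgeForm f hlam.le (θ - θ')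
  have hsample := sqrt_sampleForm_le_sqrt_ridgeForm f hlam.le (θ - θ')
  set z := θ - θ'
  set e := √(ridgeForm f lam z)
  have hlam' : 0 < √lam := Real.sqrt_pos.2 hlam
  have hbias : lam * inner ℝ θ z ≤ √lam * ‖θ‖ * e := by
    calc lam * inner ℝ θ z ≤ lam * (‖θ‖ * ‖z‖) := by gcongr; exact real_inner_le_norm _ _
      _ = √lam * ‖θ‖ * (√lam * ‖z‖) := by
          linear_combination (-(‖θ‖ * ‖z‖)) * Real.sq_sqrt hlam.le
      _ ≤ _ := by gcongr
  have hnoise : -inner ℝ (∑ i, n i • f i) z ≤ ‖∑ i, n i • f i‖ / √lam * e := by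
    calc -inner ℝ (∑ i, n i • f i) z ≤ ‖∑ i, n i • f i‖ * ‖z‖ :=
          (neg_le_abs _).trans (abs_real_inner_le_norm _ _)
      _ = ‖∑ i, n i • f i‖ / √lam * (√lam * ‖z‖) := by
          rw [← mul_assoc, div_mul_cancel₀ _ hlam'.ne']
      _ ≤ _ := by gcongr
  have hmis : ∑ i, x i * inner ℝ (f i) z ≤ √(∑ i, x i ^ 2) * e :=
    (Real.sum_mul_le_sqrt_mul_sqrt _ _ _).trans (by gcongr; exact hsample)
  have he0 : 0 ≤ e := Real.sqrt_nonneg _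
  rcases he0.eq_or_lt with he | he
  · rw [← he]; positivity
  · refine le_of_mul_le_mul_right ?_ he
    linarith [Real.mul_self_sqrt (ridgeForm_nonneg f hlam.le z)]

end RidgeRegression

section BackwardRecursion

theorem le_mul_prod_Ioc_of_backward_recursion {m H : ℕ} (hmH : m ≤ H) {a : ℝ} (ha : 0 ≤ a)
    {e b : ℕ → ℝ} (hb : ∀ h ∈ Set.Ioc m H, 1 ≤ b h) (hH : e H ≤ a)
    (hstep : ∀ h ∈ Set.Ico m H, e h ≤ a + b (h + 1) * e (h + 1)) :
    e m ≤ (H - m + 1) * a * ∏ h ∈ Finset.Ioc m H, b h := by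
  induction hmH using Nat.decreasingInduction with
  | self => simpa using hH
  | of_succ m hm ih =>
    have hbm : 1 ≤ b (m + 1) := hb (m + 1) ⟨by lia, hm⟩
    have hone : 1 ≤ ∏ h ∈ Finset.Ioc m H, b h :=
      Finset.one_le_prod fun h hh => hb h (Finset.mem_Ioc.1 hh)
    calc e m ≤ a + b (m + 1) * e (m + 1) := hstep m ⟨le_rfl, hm⟩
      _ ≤ a + b (m + 1) * ((H - (m + 1 : ℕ) + 1) * a * ∏ h ∈ Finset.Ioc (m + 1) H, b h) := by
          gcongr
          exact ih (fun h hh => hb h ⟨by have := hh.1; lia, hh.2⟩)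
            fun h hh => hstep h ⟨by have := hh.1; lia, hh.2⟩
      _ = a * 1 + (H - m) * a * ∏ h ∈ Finset.Ioc m H, b h := by
          rw [← Finset.insert_Ioc_add_one_left_eq_Ioc hm, Finset.prod_insert (by simp)]
          push_cast
          ring
      _ ≤ a * ∏ h ∈ Finset.Ioc m H, b h + (H - m) * a * ∏ h ∈ Finset.Ioc m H, b h := by gcongr
      _ = _ := by ring

theorem mul_sq_prod_Ioc_sqrt {m H : ℕ} (hmH : m ≤ H) {g : ℕ → ℝ}
    (hg : ∀ h ∈ Set.Ioc m H, 0 ≤ g h) :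
    g m * (∏ h ∈ Finset.Ioc m H, √(g h)) ^ 2 = ∏ h ∈ Finset.Icc m H, g h := by
  rw [← Finset.prod_pow, ← Finset.mul_prod_Ioc_eq_prod_Icc hmH]
  congr 1
  exact Finset.prod_congr rfl fun h hh => Real.sq_sqrt (hg h (Finset.mem_Ioc.1 hh))

end BackwardRecursion

section Noise

variable {S A E : Type*}

/-- The feature `φ (s, a)` of the state-action pair of a sample `((s, a), (r, s'))`. -/
def currentFeature (φ : S → A → E) (y : Sample S A) : E :=
  φ y.1.1 y.1.2

/-- The feature `φ (s', π s')` of the successor state of a sample `((s, a), (r, s'))`. -/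
def nextFeature (φ : S → A → E) (π : S → A) (y : Sample S A) : E :=
  φ y.2.2 (π y.2.2)

theorem measurable_currentFeature [MeasurableSpace S] [MeasurableSpace A] [MeasurableSpace E]
    {φ : S → A → E} (hφ : Measurable fun p : S × A => φ p.1 p.2) :
    Measurable (currentFeature φ) :=
  hφ.comp measurable_fst

theorem measurable_feature_policy [MeasurableSpace S] [MeasurableSpace A] [MeasurableSpace E]
    {φ : S → A → E} {π : S → A} (hφ : Measurable fun p : S × A => φ p.1 p.2) (hπ : Measurable π) :
    Measurable fun s => φ s (π s) :=
  hφ.comp (measurable_id.prodMk hπ)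

theorem measurable_nextFeature [MeasurableSpace S] [MeasurableSpace A] [MeasurableSpace E]
    {φ : S → A → E} {π : S → A} (hφ : Measurable fun p : S × A => φ p.1 p.2) (hπ : Measurable π) :
    Measurable (nextFeature φ π) :=
  (measurable_feature_policy hφ hπ).comp (measurable_snd.comp measurable_snd)

variable [NormedAddCommGroup E] [InnerProductSpace ℝ E]

/-- The deviation of the reward plus the value of the successor state from the value of the current
state-action pair, where the values are `⟪φ, θ'⟫` and `⟪φ, θ⟫`. By the Bellman equation it has
conditional mean zero when `θ` and `θ'` realize the `Q`-functions of two consecutive levels. -/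
noncomputable def noise (φ : S → A → E) (π : S → A) (θ θ' : E) (y : Sample S A) : ℝ :=
  y.2.1 + inner ℝ (nextFeature φ π y) θ' - inner ℝ (currentFeature φ y) θ

variable {φ : S → A → E} {π : S → A}

theorem abs_inner_feature_le (hφ1 : ∀ s a, ‖φ s a‖ ≤ 1) (s : S) (a : A) (θ : E) :
    |inner ℝ (φ s a) θ| ≤ ‖θ‖ :=
  (abs_real_inner_le_norm _ _).trans (mul_le_of_le_one_left (norm_nonneg _) (hφ1 s a))

theorem norm_noise_smul_le (hφ1 : ∀ s a, ‖φ s a‖ ≤ 1) (θ θ' : E) {y : Sample S A}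
    (hy : |y.2.1| ≤ 1) : ‖noise φ π θ θ' y • currentFeature φ y‖ ≤ 1 + ‖θ‖ + ‖θ'‖ := by
  calc ‖noise φ π θ θ' y • currentFeature φ y‖
      = |noise φ π θ θ' y| * ‖currentFeature φ y‖ := norm_smul _ _
    _ ≤ |noise φ π θ θ' y| := mul_le_of_le_one_right (abs_nonneg _) (hφ1 _ _)
    _ ≤ |y.2.1| + |inner ℝ (nextFeature φ π y) θ'| + |inner ℝ (currentFeature φ y) θ| :=
        (abs_sub _ _).trans (by gcongr; exact abs_add_le _ _)
    _ ≤ 1 + ‖θ'‖ + ‖θ‖ := by gcongr <;> exact abs_inner_feature_le hφ1 _ _ _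
    _ = _ := by ring

variable [MeasurableSpace S] [MeasurableSpace A]

instance (M : MDP S A) (μ : Measure (S × A)) [IsProbabilityMeasure μ] :
    IsProbabilityMeasure (sampleLaw M μ) := by
  unfold sampleLaw
  infer_instance

/-- The parameters `θ h` are bounded by `B` and realize the `Q`-functions of `π` at all levels;
above level `H`, where the `Q`-functions vanish, they are `0`. -/
structure Realizes (M : MDP S A) (φ : S → A → E) (π : S → A) (B : ℝ) (θ : ℕ → E) : Prop where
  norm_le : ∀ h, ‖θ h‖ ≤ B
  Q_eq : ∀ h ∈ Set.Icc 1 M.H, ∀ s ∈ M.level h, ∀ a, M.Q π h s a = inner ℝ (φ s a) (θ h)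
  eq_zero : ∀ h, M.H < h → θ h = 0

variable {M : MDP S A} {h : ℕ} {μ : Measure (S × A)}

theorem exists_realizes {B : ℝ} (hreal : ∀ h ∈ Set.Icc 1 M.H, ∃ θ : E, ‖θ‖ ≤ B ∧
    ∀ s ∈ M.level h, ∀ a, M.Q π h s a = inner ℝ (φ s a) θ) :
    ∃ θ : ℕ → E, Realizes M φ π B θ := by
  obtain ⟨θ₁, hθ₁, -⟩ := hreal 1 ⟨le_rfl, M.H_pos⟩
  choose! θ hθ hQ using hreal
  refine ⟨fun h => if h ∈ Set.Icc 1 M.H then θ h else 0, fun h => ?_, fun h hh => ?_,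
    fun h hh => if_neg fun hmem => hh.not_ge hmem.2⟩
  · split_ifs with hh
    · exact hθ h hh
    · simpa using (norm_nonneg θ₁).trans hθ₁
  · simpa only [if_pos hh] using hQ h hh

theorem Realizes.ae_Q_succ_eq {B : ℝ} {θ : ℕ → E} (hθ : Realizes M φ π B θ)
    (hh : h ∈ Set.Icc 1 M.H) {s : S} (hs : s ∈ M.level h) (a : A) :
    ∀ᵐ s' ∂(M.P (s, a)), M.Q π (h + 1) s' (π s') = inner ℝ (φ s' (π s')) (θ (h + 1)) := by
  rcases hh.2.eq_or_lt with rfl | hlt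
  · refine ae_of_all _ fun s' => ?_
    rw [M.Q_eq_zero π (Nat.lt_succ_self _), hθ.eq_zero _ (Nat.lt_succ_self _), inner_zero_right]
  · filter_upwards [M.level_step h hh.1 hlt s hs a] with s' hs'
    exact hθ.Q_eq (h + 1) ⟨by lia, hlt⟩ s' hs' _

theorem ae_sampleLaw_abs_reward_le [SFinite μ] (hh : h ∈ Set.Icc 1 M.H)
    (hμ : ∀ᵐ p ∂μ, p.1 ∈ M.level h) : ∀ᵐ y ∂(sampleLaw M μ), |y.2.1| ≤ 1 := by
  have hmeas : Measurable fun y : Sample S A => |y.2.1| := by fun_prop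
  refine Measure.ae_compProd_of_ae_ae (measurableSet_le hmeas measurable_const) ?_
  filter_upwards [hμ] with p hp
  rw [Kernel.prod_apply]
  exact Measure.quasiMeasurePreserving_fst.ae (p := fun r => |r| ≤ 1)
    ((M.reward_bound h hh p.1 hp p.2).mono fun r hr => abs_le.2 hr)

theorem integral_noise_prod {p : S × A} {θ θ' : E} (hR : Integrable id (M.R p))
    (hP : Integrable (fun s' => inner ℝ (φ s' (π s')) θ') (M.P p)) :
    ∫ q, noise φ π θ θ' (p, q) ∂((M.R p).prod (M.P p)) =
      ∫ r, r ∂(M.R p) + ∫ s', inner ℝ (φ s' (π s')) θ' ∂(M.P p) - inner ℝ (φ p.1 p.2) θ := by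
  have hR' : Integrable (fun q : ℝ × S => q.1) ((M.R p).prod (M.P p)) := hR.comp_fst _
  have hP' : Integrable (fun q : ℝ × S => inner ℝ (φ q.2 (π q.2)) θ') ((M.R p).prod (M.P p)) :=
    hP.comp_snd _
  simp only [noise, currentFeature, nextFeature]
  rw [integral_sub (by exact hR'.add hP') (integrable_const _), integral_add hR' hP',
    integral_fun_fst (f := fun r : ℝ => r),
    integral_fun_snd (f := fun s' => inner ℝ (φ s' (π s')) θ')]
  simp only [probReal_univ, one_smul, integral_const]

variable [MeasurableSpace E] [BorelSpace E] [SecondCountableTopology E]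

theorem measurable_noise_smul (hφ : Measurable fun p : S × A => φ p.1 p.2) (hπ : Measurable π)
    (θ θ' : E) : Measurable fun y => noise φ π θ θ' y • currentFeature φ y := by
  have hcur := measurable_currentFeature hφ
  have hnext := measurable_nextFeature hφ hπ
  unfold noise
  fun_prop

theorem Realizes.integral_noise_smul_eq_zero [CompleteSpace E] {B : ℝ} {θ : ℕ → E}
    (hθ : Realizes M φ π B θ) (hφ : Measurable fun p : S × A => φ p.1 p.2) (hπ : Measurable π)
    (hφ1 : ∀ s a, ‖φ s a‖ ≤ 1) (hh : h ∈ Set.Icc 1 M.H) [IsProbabilityMeasure μ]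
    (hμ : ∀ᵐ p ∂μ, p.1 ∈ M.level h) :
    ∫ y, noise φ π (θ h) (θ (h + 1)) y • currentFeature φ y ∂(sampleLaw M μ) = 0 := by
  have hint : Integrable (fun y => noise φ π (θ h) (θ (h + 1)) y • currentFeature φ y)
      (sampleLaw M μ) :=
    Integrable.of_bound (measurable_noise_smul hφ hπ _ _).aestronglyMeasurable _
      ((ae_sampleLaw_abs_reward_le hh hμ).mono fun y => norm_noise_smul_le hφ1 _ _)
  have hP (p : S × A) : Integrable (fun s' => inner ℝ (φ s' (π s')) (θ (h + 1))) (M.P p) :=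
    Integrable.of_bound
      ((measurable_feature_policy hφ hπ).inner measurable_const).aestronglyMeasurable _
      (ae_of_all _ fun s' => abs_inner_feature_le hφ1 s' (π s') (θ (h + 1)))
  have hmean (p : S × A) (hp : p.1 ∈ M.level h) :
      ∫ q, noise φ π (θ h) (θ (h + 1)) (p, q) ∂((M.R p).prod (M.P p)) = 0 := by
    rw [integral_noise_prod (M.integrable_reward hh hp p.2) (hP p),
      ← integral_congr_ae (hθ.ae_Q_succ_eq hh hp p.2), ← hθ.Q_eq h hh p.1 hp,
      M.Q_eq_integral_add hπ hh hp, sub_self]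
  rw [sampleLaw] at hint ⊢
  rw [Measure.integral_compProd hint]
  refine integral_eq_zero_of_ae ?_
  filter_upwards [hμ] with p hp
  simp only [currentFeature, Kernel.prod_apply, integral_smul_const, hmean p hp, zero_smul,
    Pi.zero_apply]

end Noise

section Typical

variable {S A E : Type*} [NormedAddCommGroup E] [InnerProductSpace ℝ E] [MeasurableSpace S]
  [MeasurableSpace A] {ι : Type*} [Fintype ι]

/-- The event on which the dataset `D` of one level behaves as expected: both empirical covariances
are close to those of the law `ν` of a sample, and the noise averages out. -/
structure IsTypical (φ : S → A → E) (π : S → A) (ν : Measure (Sample S A)) (θ θ' : E) (r b : ℝ)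
    (D : ι → Sample S A) : Prop where
  abs_current_sub_le : ∀ v, |sampleForm (fun i => currentFeature φ (D i)) v
    - Fintype.card ι * populationForm ν (currentFeature φ) v| ≤ r * ‖v‖ ^ 2
  abs_next_sub_le : ∀ v, |sampleForm (fun i => nextFeature φ π (D i)) v
    - Fintype.card ι * populationForm ν (nextFeature φ π) v| ≤ r * ‖v‖ ^ 2
  norm_noise_le : ‖∑ i, noise φ π θ θ' (D i) • currentFeature φ (D i)‖ ≤ b

variable {φ : S → A → E} {π : S → A} {M : MDP S A} {B x : ℝ} {θ : ℕ → E} {h : ℕ}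
  [Nonempty ι] {Ω : Type*} [MeasurableSpace Ω] {Pr : Measure Ω} [IsProbabilityMeasure Pr]

theorem Realizes.measureReal_not_isTypical_le [FiniteDimensional ℝ E] [MeasurableSpace E]
    [BorelSpace E] (hθ : Realizes M φ π B θ) (hφ : Measurable fun p : S × A => φ p.1 p.2)
    (hπ : Measurable π) (hφ1 : ∀ s a, ‖φ s a‖ ≤ 1) (hh : h ∈ Set.Icc 1 M.H)
    {μ : Measure (S × A)} [IsProbabilityMeasure μ] (hμ : ∀ᵐ p ∂μ, p.1 ∈ M.level h)
    {D : ι → Ω → Sample S A} (hD : ∀ i, HasLaw (D i) (sampleLaw M μ) Pr) (hind : iIndepFun D Pr)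
    (hx : 0 ≤ x) :
    Pr.real {ω | ¬ IsTypical φ π (sampleLaw M μ) (θ h) (θ (h + 1))
      (2 * √(2 * Fintype.card ι * x)) ((1 + 2 * B) * √(2 * Fintype.card ι * x))
      fun i => D i ω} ≤ 6 * Real.exp (-x) := by
  have hcur := measureReal_exists_lt_abs_sampleForm_sub_le hD hind
    (measurable_currentFeature hφ) (fun y => hφ1 _ _) hx
  have hnext := measureReal_exists_lt_abs_sampleForm_sub_le hD hind
    (measurable_nextFeature hφ hπ) (fun y => hφ1 _ _) hx
  have hB : 0 ≤ B := (norm_nonneg _).trans (hθ.norm_le h)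
  have hnoise := measureReal_le_norm_sum_comp_le hD hind (b := 1 + 2 * B)
    (measurable_noise_smul hφ hπ (θ h) (θ (h + 1))) (by positivity)
    ((ae_sampleLaw_abs_reward_le hh hμ).mono fun y hy => (norm_noise_smul_le hφ1 _ _ hy).trans
      (by linarith [hθ.norm_le h, hθ.norm_le (h + 1)]))
    (hθ.integral_noise_smul_eq_zero hφ hπ hφ1 hh hμ) hx
  refine (measureReal_mono fun ω hω => ?_).trans ((measureReal_union_le _ _).trans
    ((add_le_add ((measureReal_union_le _ _).trans (add_le_add hcur hnext)) hnoise).trans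
    (by linarith)))
  simp only [Set.mem_union, Set.mem_ofPred_eq]
  contrapose! hω
  exact not_not.2 ⟨hω.1.1, hω.1.2, hω.2.le⟩

end Typical

section Propagation

variable {S A E : Type*} [NormedAddCommGroup E] [InnerProductSpace ℝ E] {ι : Type*} [Fintype ι]

/-- The parameters `θ' h` are the estimates of Least-Squares Policy Evaluation on the datasets
`D h`, characterized by the normal equations of ridge regression instead of a matrix inverse. -/
structure IsLSPE (φ : S → A → E) (π : S → A) (lam : ℝ) (H : ℕ) (D : ℕ → ι → Sample S A)
    (θ' : ℕ → E) : Prop where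
  normal_eq : ∀ h ∈ Set.Icc 1 H,
    ∑ i, inner ℝ (currentFeature φ (D h i)) (θ' h) • currentFeature φ (D h i) + lam • θ' h =
      ∑ i, ((D h i).2.1 + inner ℝ (nextFeature φ π (D h i)) (θ' (h + 1))) •
        currentFeature φ (D h i)
  eq_zero : θ' (H + 1) = 0

variable {φ : S → A → E} {π : S → A} {lam : ℝ} {D : ℕ → ι → Sample S A} {θ θ' : ℕ → E} {h : ℕ}

theorem IsLSPE.sqrt_ridgeForm_sub_le {H : ℕ} (hθ' : IsLSPE φ π lam H D θ') (hlam : 0 < lam)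
    (hh : h ∈ Set.Icc 1 H) (θ : ℕ → E) :
    √(ridgeForm (fun i => currentFeature φ (D h i)) lam (θ h - θ' h)) ≤
      √lam * ‖θ h‖
        + ‖∑ i, noise φ π (θ h) (θ (h + 1)) (D h i) • currentFeature φ (D h i)‖ / √lam
        + √(sampleForm (fun i => nextFeature φ π (D h i)) (θ (h + 1) - θ' (h + 1))) := by
  refine OfflineRL.sqrt_ridgeForm_sub_le hlam
    (x := fun i => inner ℝ (nextFeature φ π (D h i)) (θ (h + 1) - θ' (h + 1))) ?_
  rw [hθ'.normal_eq h hh]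
  refine Finset.sum_congr rfl fun i _ => ?_
  congr 1
  simp only [noise, inner_sub_right]
  ring

variable [MeasurableSpace S] [MeasurableSpace A]

/-- The quadratic form of the covariance of the one-step lookahead distribution at level `h`: that
of the initial feature at level `1`, and that of the successor features of the samples of the
previous level at the other levels. -/
noncomputable def lookaheadForm (M : MDP S A) (φ : S → A → E) (π : S → A)
    (μ : ℕ → Measure (S × A)) (h : ℕ) (v : E) : ℝ :=
  if h = 1 then inner ℝ (φ M.s₁ (π M.s₁)) v ^ 2
  else populationForm (sampleLaw M (μ (h - 1))) (nextFeature φ π) v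

/-- The data covers the lookahead distribution of every level `h` up to the factor `Cs h`. -/
def HasBoundedShift (M : MDP S A) (φ : S → A → E) (π : S → A) (μ : ℕ → Measure (S × A))
    (Cs : ℕ → ℝ) : Prop :=
  ∀ h ∈ Set.Icc 1 M.H, 1 ≤ Cs h ∧
    ∀ v, lookaheadForm M φ π μ h v ≤
      Cs h * populationForm (sampleLaw M (μ h)) (currentFeature φ) v

variable {M : MDP S A} {μ : ℕ → Measure (S × A)} {Cs : ℕ → ℝ} {r b B : ℝ}

theorem lookaheadForm_one (v : E) :
    lookaheadForm M φ π μ 1 v = inner ℝ (φ M.s₁ (π M.s₁)) v ^ 2 :=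
  if_pos rfl

theorem lookaheadForm_succ (hh : 1 ≤ h) (v : E) :
    lookaheadForm M φ π μ (h + 1) v =
      populationForm (sampleLaw M (μ h)) (nextFeature φ π) v :=
  if_neg (by lia)

theorem HasBoundedShift.card_mul_lookaheadForm_add_le (hshift : HasBoundedShift M φ π μ Cs)
    (hlam : 0 < lam) (hr : 0 ≤ r) (hh : h ∈ Set.Icc 1 M.H) {ϑ ϑ' : E}
    (htyp : IsTypical φ π (sampleLaw M (μ h)) ϑ ϑ' r b (D h)) (v : E) :
    Fintype.card ι * lookaheadForm M φ π μ h v + r * ‖v‖ ^ 2 ≤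
      (1 + 2 * r / lam) * Cs h * ridgeForm (fun i => currentFeature φ (D h i)) lam v := by
  obtain ⟨hCs, hcover⟩ := hshift h hh
  set f := fun i => currentFeature φ (D h i)
  have hC0 : 0 ≤ Cs h := zero_le_one.trans hCs
  have hpop : Fintype.card ι * populationForm (sampleLaw M (μ h)) (currentFeature φ) v ≤
      sampleForm f v + r * ‖v‖ ^ 2 := by
    linarith [(abs_le.1 (htyp.abs_current_sub_le v)).1]
  have hreg : r * ‖v‖ ^ 2 ≤ r / lam * ridgeForm f lam v := by
    calc r * ‖v‖ ^ 2 = r / lam * (lam * ‖v‖ ^ 2) := by field_simp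
      _ ≤ _ := by gcongr; exact le_add_of_nonneg_left (sampleForm_nonneg f v)
  calc Fintype.card ι * lookaheadForm M φ π μ h v + r * ‖v‖ ^ 2
      ≤ Cs h * (Fintype.card ι * populationForm (sampleLaw M (μ h)) (currentFeature φ) v)
        + r * ‖v‖ ^ 2 := by
        rw [mul_left_comm]
        gcongr
        exact hcover v
    _ ≤ Cs h * (sampleForm f v + r * ‖v‖ ^ 2) + Cs h * (r * ‖v‖ ^ 2) := by
        refine add_le_add (mul_le_mul_of_nonneg_left hpop hC0) (le_mul_of_one_le_left ?_ hCs)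
        positivity
    _ = Cs h * (sampleForm f v + 2 * (r * ‖v‖ ^ 2)) := by ring
    _ ≤ Cs h * (ridgeForm f lam v + 2 * (r / lam * ridgeForm f lam v)) := by
        gcongr
        exact le_add_of_nonneg_right (by positivity)
    _ = _ := by ring

theorem HasBoundedShift.sqrt_sampleForm_nextFeature_le (hshift : HasBoundedShift M φ π μ Cs)
    (hlam : 0 < lam) (hr : 0 ≤ r) (hh : 1 ≤ h) (hlt : h < M.H)
    (htyp : ∀ h ∈ Set.Icc 1 M.H,
      IsTypical φ π (sampleLaw M (μ h)) (θ h) (θ (h + 1)) r b (D h)) (v : E) :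
    √(sampleForm (fun i => nextFeature φ π (D h i)) v) ≤ √((1 + 2 * r / lam) * Cs (h + 1))
      * √(ridgeForm (fun i => currentFeature φ (D (h + 1) i)) lam v) := by
  have hsucc : h + 1 ∈ Set.Icc 1 M.H := ⟨by lia, hlt⟩
  have hC0 : 0 ≤ Cs (h + 1) := zero_le_one.trans (hshift _ hsucc).1
  have hdom := hshift.card_mul_lookaheadForm_add_le hlam hr hsucc (htyp _ hsucc) v
  have hnext := (abs_le.1 ((htyp h ⟨hh, hlt.le⟩).abs_next_sub_le v)).2
  rw [← Real.sqrt_mul (by positivity)]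
  refine Real.sqrt_le_sqrt ?_
  rw [lookaheadForm_succ hh] at hdom
  linarith

theorem IsLSPE.sqrt_ridgeForm_sub_one_le (hθ' : IsLSPE φ π lam M.H D θ')
    (hθ : Realizes M φ π B θ) (hshift : HasBoundedShift M φ π μ Cs) (hlam : 0 < lam) (hr : 0 ≤ r)
    (hb : 0 ≤ b) (htyp : ∀ h ∈ Set.Icc 1 M.H,
      IsTypical φ π (sampleLaw M (μ h)) (θ h) (θ (h + 1)) r b (D h)) :
    √(ridgeForm (fun i => currentFeature φ (D 1 i)) lam (θ 1 - θ' 1)) ≤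
      M.H * (√lam * B + b / √lam) *
        ∏ h ∈ Finset.Ioc 1 M.H, √((1 + 2 * r / lam) * Cs h) := by
  have hB : 0 ≤ B := (norm_nonneg _).trans (hθ.norm_le 1)
  have hlevel (h : ℕ) (hh : h ∈ Set.Icc 1 M.H) :
      √(ridgeForm (fun i => currentFeature φ (D h i)) lam (θ h - θ' h)) ≤ √lam * B + b / √lam
        + √(sampleForm (fun i => nextFeature φ π (D h i)) (θ (h + 1) - θ' (h + 1))) :=
    (hθ'.sqrt_ridgeForm_sub_le hlam hh θ).trans (by
      gcongr
      · exact hθ.norm_le h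
      · exact (htyp h hh).norm_noise_le)
  have hexp (h : ℕ) (hh : h ∈ Set.Ioc 1 M.H) : 1 ≤ √((1 + 2 * r / lam) * Cs h) :=
    Real.one_le_sqrt.2 (one_le_mul_of_one_le_of_one_le
      (le_add_of_nonneg_right (by positivity)) (hshift h ⟨hh.1.le, hh.2⟩).1)
  have hlast : √(ridgeForm (fun i => currentFeature φ (D M.H i)) lam (θ M.H - θ' M.H)) ≤
      √lam * B + b / √lam := by
    simpa [hθ.eq_zero _ (Nat.lt_succ_self _), hθ'.eq_zero, sampleForm]
      using hlevel M.H ⟨M.H_pos, le_rfl⟩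
  simpa using le_mul_prod_Ioc_of_backward_recursion
    (e := fun h => √(ridgeForm (fun i => currentFeature φ (D h i)) lam (θ h - θ' h)))
    M.H_pos (by positivity) hexp hlast fun h hh => (hlevel h ⟨hh.1, hh.2.le⟩).trans
      (by gcongr; exact hshift.sqrt_sampleForm_nextFeature_le hlam hr hh.1 hh.2 htyp _)

theorem IsLSPE.card_mul_sq_inner_sub_le (hθ' : IsLSPE φ π lam M.H D θ')
    (hθ : Realizes M φ π B θ) (hshift : HasBoundedShift M φ π μ Cs) (hlam : 0 < lam) (hr : 0 ≤ r)
    (hb : 0 ≤ b) (htyp : ∀ h ∈ Set.Icc 1 M.H,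
      IsTypical φ π (sampleLaw M (μ h)) (θ h) (θ (h + 1)) r b (D h)) :
    Fintype.card ι * inner ℝ (φ M.s₁ (π M.s₁)) (θ 1 - θ' 1) ^ 2 ≤
      (∏ h ∈ Finset.Icc 1 M.H, Cs h) * (1 + 2 * r / lam) ^ M.H
        * (M.H * (√lam * B + b / √lam)) ^ 2 := by
  have h1 : 1 ∈ Set.Icc 1 M.H := ⟨le_rfl, M.H_pos⟩
  have hC0 (h : ℕ) (hh : h ∈ Set.Icc 1 M.H) : 0 ≤ Cs h := zero_le_one.trans (hshift h hh).1
  have hC1 := hC0 1 h1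
  have hdom := hshift.card_mul_lookaheadForm_add_le hlam hr h1 (htyp 1 h1) (θ 1 - θ' 1)
  rw [lookaheadForm_one] at hdom
  set ρ := 1 + 2 * r / lam
  have hρ : 0 ≤ ρ := by positivity
  have hprod : ρ * Cs 1 * (∏ h ∈ Finset.Ioc 1 M.H, √(ρ * Cs h)) ^ 2 =
      (∏ h ∈ Finset.Icc 1 M.H, Cs h) * ρ ^ M.H := by
    rw [mul_sq_prod_Ioc_sqrt (g := fun h => ρ * Cs h) M.H_pos fun h hh => mul_nonneg hρ
      (hC0 h (Set.Ioc_subset_Icc_self hh))]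
    simp [Finset.prod_mul_distrib, mul_comm]
  calc _ ≤ ρ * Cs 1 * ridgeForm (fun i => currentFeature φ (D 1 i)) lam (θ 1 - θ' 1) :=
        (le_add_of_nonneg_right (by positivity)).trans hdom
    _ = ρ * Cs 1 *
        √(ridgeForm (fun i => currentFeature φ (D 1 i)) lam (θ 1 - θ' 1)) ^ 2 := by
        rw [Real.sq_sqrt (ridgeForm_nonneg _ hlam.le _)]
    _ ≤ ρ * Cs 1 * (M.H * (√lam * B + b / √lam) *
        ∏ h ∈ Finset.Ioc 1 M.H, √(ρ * Cs h)) ^ 2 := by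
        gcongr
        exact hθ'.sqrt_ridgeForm_sub_one_le hθ hshift hlam hr hb htyp
    _ = _ := by rw [← hprod]; ring

end Propagation

section HighProbability

variable {S A E : Type*} [NormedAddCommGroup E] [InnerProductSpace ℝ E] [FiniteDimensional ℝ E]
  [MeasurableSpace E] [BorelSpace E] [MeasurableSpace S] [MeasurableSpace A]
  {ι : Type*} [Fintype ι] [Nonempty ι] {Ω : Type*} [MeasurableSpace Ω] {Pr : Measure Ω}
  [IsProbabilityMeasure Pr]

theorem measureReal_lt_card_mul_sq_error_le {M : MDP S A} {φ : S → A → E} {π : S → A}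
    (hφ : Measurable fun p : S × A => φ p.1 p.2) (hπ : Measurable π) (hφ1 : ∀ s a, ‖φ s a‖ ≤ 1)
    {μ : ℕ → Measure (S × A)}
    (hμ : ∀ h ∈ Set.Icc 1 M.H, IsProbabilityMeasure (μ h) ∧ ∀ᵐ p ∂(μ h), p.1 ∈ M.level h)
    {D : ℕ → ι → Ω → Sample S A}
    (hD : ∀ h ∈ Set.Icc 1 M.H, (∀ i, HasLaw (D h i) (sampleLaw M (μ h)) Pr) ∧ iIndepFun (D h) Pr)
    {B : ℝ} (hreal : ∀ h ∈ Set.Icc 1 M.H, ∃ θ : E, ‖θ‖ ≤ B ∧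
      ∀ s ∈ M.level h, ∀ a, M.Q π h s a = inner ℝ (φ s a) θ)
    {Cs : ℕ → ℝ} (hshift : HasBoundedShift M φ π μ Cs) {lam : ℝ} (hlam : 0 < lam)
    {θ' : Ω → ℕ → E} (hθ' : ∀ ω, IsLSPE φ π lam M.H (fun h i => D h i ω) (θ' ω))
    {x : ℝ} (hx : 0 ≤ x) :
    Pr.real {ω | (∏ h ∈ Finset.Icc 1 M.H, Cs h)
        * (1 + 2 * (2 * √(2 * Fintype.card ι * x)) / lam) ^ M.H
        * (M.H * (√lam * B + (1 + 2 * B) * √(2 * Fintype.card ι * x) / √lam)) ^ 2 <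
      Fintype.card ι
        * (M.Q π 1 M.s₁ (π M.s₁) - inner ℝ (φ M.s₁ (π M.s₁)) (θ' ω 1)) ^ 2} ≤
      M.H * (6 * Real.exp (-x)) := by
  obtain ⟨θ, hθ⟩ := exists_realizes hreal
  have hB : 0 ≤ B := (norm_nonneg _).trans (hθ.norm_le 1)
  let bad (h : ℕ) : Set Ω := {ω | ¬ IsTypical φ π (sampleLaw M (μ h)) (θ h) (θ (h + 1))
    (2 * √(2 * Fintype.card ι * x)) ((1 + 2 * B) * √(2 * Fintype.card ι * x)) fun i => D h i ω}
  have hbad (h : ℕ) (hh : h ∈ Finset.Icc 1 M.H) : Pr.real (bad h) ≤ 6 * Real.exp (-x) := by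
    have hh := Finset.mem_Icc.1 hh
    have := (hμ h hh).1
    exact hθ.measureReal_not_isTypical_le hφ hπ hφ1 hh (hμ h hh).2 (hD h hh).1 (hD h hh).2 hx
  calc _ ≤ Pr.real (⋃ h ∈ Finset.Icc 1 M.H, bad h) :=
        measureReal_mono (fun ω hω => ?_) (measure_ne_top _ _)
    _ ≤ ∑ h ∈ Finset.Icc 1 M.H, Pr.real (bad h) := measureReal_biUnion_finset_le _ _
    _ ≤ ∑ h ∈ Finset.Icc 1 M.H, 6 * Real.exp (-x) := Finset.sum_le_sum hbad
    _ = M.H * (6 * Real.exp (-x)) := by simp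
  contrapose! hω
  simp only [Set.mem_iUnion, not_exists, bad, Set.mem_ofPred_eq, not_not, Finset.mem_Icc] at hω
  rw [Set.mem_ofPred_eq, not_lt, hθ.Q_eq 1 ⟨le_rfl, M.H_pos⟩ _ M.s₁_mem, ← inner_sub_right]
  exact (hθ' ω).card_mul_sq_inner_sub_le hθ hshift hlam (by positivity) (by positivity) hω

end HighProbability

section Matrices

variable {d N : ℕ}

theorem vecMulVec_mulVec_ofLp (x y : EuclideanSpace ℝ (Fin d)) :
    Matrix.vecMulVec x x *ᵥ y.ofLp = (inner ℝ x y • x).ofLp := by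
  rw [Matrix.vecMulVec_mulVec, EuclideanSpace.inner_eq_star_dotProduct, star_trivial,
    dotProduct_comm]
  ext i
  simp [mul_comm]

section Estimate

variable {S A : Type*} (φ : S → A → EuclideanSpace ℝ (Fin d)) (π : S → A) {lam : ℝ}

theorem empCov_mulVec (lam : ℝ) (D : Fin N → Sample S A) (y : EuclideanSpace ℝ (Fin d)) :
    empCov φ lam D *ᵥ y.ofLp = (∑ i, inner ℝ (currentFeature φ (D i)) y • currentFeature φ (D i)
      + lam • y).ofLp := by
  rw [empCov, Matrix.add_mulVec, Matrix.sum_mulVec]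
  simp only [vecMulVec_mulVec_ofLp, Matrix.smul_mulVec, Matrix.one_mulVec, WithLp.ofLp_add,
    WithLp.ofLp_sum, WithLp.ofLp_smul, currentFeature]

theorem isUnit_empCov (hlam : 0 < lam) (D : Fin N → Sample S A) : IsUnit (empCov φ lam D) := by
  refine Matrix.PosDef.isUnit (Matrix.PosDef.posSemidef_add
    (Matrix.posSemidef_sum _ fun i _ => ?_) (Matrix.PosDef.one.smul hlam))
  simpa using Matrix.posSemidef_vecMulVec_self_star (φ (D i).1.1 (D i).1.2).ofLp

theorem isLSPE_thetaHat (hlam : 0 < lam) (H : ℕ) (D : ℕ → Fin N → Sample S A) :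
    IsLSPE φ π lam H D (thetaHat φ π lam H D) where
  normal_eq h hh := by
    refine WithLp.ofLp_injective 2 ((empCov_mulVec φ lam (D h) _).symm.trans ?_)
    rw [thetaHat, if_pos hh.2, Matrix.mulVec_mulVec, Matrix.mul_nonsing_inv _
      ((Matrix.isUnit_iff_isUnit_det _).1 (isUnit_empCov φ hlam _)), Matrix.one_mulVec]
    rfl
  eq_zero := by rw [thetaHat, if_neg (by lia)]

end Estimate

theorem norm_coord_mul_le {x : EuclideanSpace ℝ (Fin d)} (hx : ‖x‖ ≤ 1) (i j : Fin d) :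
    ‖x i * x j‖ ≤ 1 := by
  rw [norm_mul]
  exact mul_le_one₀ ((PiLp.norm_apply_le _ _).trans hx) (norm_nonneg _)
    ((PiLp.norm_apply_le _ _).trans hx)

theorem dotProduct_covariance_mulVec {Y : Type*} [MeasurableSpace Y] {ν : Measure Y}
    [IsFiniteMeasure ν] {f : Y → EuclideanSpace ℝ (Fin d)} (hf : Measurable f)
    (hf1 : ∀ y, ‖f y‖ ≤ 1) (v : EuclideanSpace ℝ (Fin d)) :
    v.ofLp ⬝ᵥ ((Matrix.of fun i j => ∫ y, f y i * f y j ∂ν) *ᵥ v.ofLp) =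
      populationForm ν f v := by
  have hcoord (i : Fin d) : Measurable fun y => f y i := by fun_prop
  have hint (i j : Fin d) : Integrable (fun y => v i * (f y i * f y j * v j)) ν :=
    ((Integrable.of_bound ((hcoord i).mul (hcoord j)).aestronglyMeasurable 1
      (ae_of_all _ fun y => norm_coord_mul_le (hf1 y) i j)).mul_const _).const_mul _
  have hexpand (y : Y) : inner ℝ (f y) v ^ 2 = ∑ i, ∑ j, v i * (f y i * f y j * v j) := by
    simp only [PiLp.inner_apply, RCLike.inner_apply, conj_trivial, sq, Finset.sum_mul_sum]
    refine Finset.sum_congr rfl fun i _ => Finset.sum_congr rfl fun j _ => by ring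
  simp_rw [populationForm, hexpand]
  rw [integral_finsetSum _ fun i _ => integrable_finsetSum _ fun j _ => hint i j]
  simp_rw [integral_finsetSum _ fun j _ => hint _ j, integral_const_mul, integral_mul_const,
    dotProduct, Matrix.mulVec, dotProduct, Matrix.of_apply, Finset.mul_sum]

section Covariance

variable {S A : Type*} [MeasurableSpace S] [MeasurableSpace A] (M : MDP S A)
  {φ : S → A → EuclideanSpace ℝ (Fin d)} {π : S → A} {μ : ℕ → Measure (S × A)} {Cs : ℕ → ℝ}

theorem integral_sampleLaw_next (μ : Measure (S × A)) [IsProbabilityMeasure μ] {g : S → ℝ}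
    (hg : Measurable g) {b : ℝ} (hgb : ∀ s, ‖g s‖ ≤ b) :
    ∫ y, g y.2.2 ∂(sampleLaw M μ) = ∫ p, ∫ s', g s' ∂(M.P p) ∂μ := by
  have hint : Integrable (fun y : Sample S A => g y.2.2) (μ ⊗ₘ (M.R ×ₖ M.P)) :=
    Integrable.of_bound (hg.comp (measurable_snd.comp measurable_snd)).aestronglyMeasurable b
      (ae_of_all _ fun y => hgb _)
  rw [sampleLaw, Measure.integral_compProd hint]
  refine integral_congr_ae (ae_of_all _ fun p => ?_)
  simpa [Kernel.prod_apply] using integral_fun_snd (μ := M.R p) (ν := M.P p) g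

theorem populationForm_sampleLaw_currentFeature (hφ : Measurable fun p : S × A => φ p.1 p.2)
    (μ : Measure (S × A)) [SFinite μ] (v : EuclideanSpace ℝ (Fin d)) :
    populationForm (sampleLaw M μ) (currentFeature φ) v =
      populationForm μ (fun p => φ p.1 p.2) v := by
  simp only [populationForm, sampleLaw]
  conv_rhs => rw [← Measure.fst_compProd μ (M.R ×ₖ M.P)]
  rw [Measure.fst, integral_map measurable_fst.aemeasurable
    (Measurable.aestronglyMeasurable (by fun_prop))]
  rfl

theorem dotProduct_featCov_mulVec (hφ : Measurable fun p : S × A => φ p.1 p.2)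
    (hφ1 : ∀ s a, ‖φ s a‖ ≤ 1) (μ : Measure (S × A)) [IsFiniteMeasure μ]
    (v : EuclideanSpace ℝ (Fin d)) :
    v.ofLp ⬝ᵥ (featCov φ μ *ᵥ v.ofLp) =
      populationForm (sampleLaw M μ) (currentFeature φ) v := by
  rw [populationForm_sampleLaw_currentFeature M hφ]
  exact dotProduct_covariance_mulVec hφ (fun p => hφ1 _ _) v

theorem dotProduct_lookaheadCov_one_mulVec (v : EuclideanSpace ℝ (Fin d)) :
    v.ofLp ⬝ᵥ (lookaheadCov M φ π μ 1 *ᵥ v.ofLp) = lookaheadForm M φ π μ 1 v := by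
  rw [lookaheadForm_one, lookaheadCov, if_pos rfl, vecMulVec_mulVec_ofLp, WithLp.ofLp_smul,
    dotProduct_smul, smul_eq_mul, sq, EuclideanSpace.inner_eq_star_dotProduct, star_trivial]

theorem dotProduct_lookaheadCov_succ_mulVec (hφ : Measurable fun p : S × A => φ p.1 p.2)
    (hπ : Measurable π) (hφ1 : ∀ s a, ‖φ s a‖ ≤ 1) {h : ℕ} (hh : 1 ≤ h)
    [IsProbabilityMeasure (μ h)] (v : EuclideanSpace ℝ (Fin d)) :
    v.ofLp ⬝ᵥ (lookaheadCov M φ π μ (h + 1) *ᵥ v.ofLp) = lookaheadForm M φ π μ (h + 1) v := by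
  have hcov : lookaheadCov M φ π μ (h + 1) = Matrix.of fun i j =>
      ∫ y, nextFeature φ π y i * nextFeature φ π y j ∂(sampleLaw M (μ h)) := by
    rw [lookaheadCov, if_neg (by lia), Nat.add_sub_cancel]
    ext i j
    have hmeas : Measurable fun s => φ s (π s) i * φ s (π s) j := by
      have := measurable_feature_policy hφ hπ
      fun_prop
    exact (integral_sampleLaw_next M (μ h) hmeas fun s => norm_coord_mul_le (hφ1 _ _) i j).symm
  rw [lookaheadForm_succ hh, hcov]
  exact dotProduct_covariance_mulVec (measurable_nextFeature hφ hπ) (fun y => hφ1 _ _) v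

theorem hasBoundedShift_of_posSemidef (hφ : Measurable fun p : S × A => φ p.1 p.2)
    (hπ : Measurable π) (hφ1 : ∀ s a, ‖φ s a‖ ≤ 1)
    (hμ : ∀ h ∈ Set.Icc 1 M.H, IsProbabilityMeasure (μ h))
    (hshift : ∀ h ∈ Set.Icc 1 M.H, 1 ≤ Cs h ∧
      (Cs h • featCov φ (μ h) - lookaheadCov M φ π μ h).PosSemidef) :
    HasBoundedShift M φ π μ Cs := by
  refine fun h hh => ⟨(hshift h hh).1, fun v => ?_⟩
  have hlook : v.ofLp ⬝ᵥ (lookaheadCov M φ π μ h *ᵥ v.ofLp) = lookaheadForm M φ π μ h v := by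
    rcases hh.1.eq_or_lt with rfl | hlt
    · exact dotProduct_lookaheadCov_one_mulVec M v
    · obtain ⟨k, rfl⟩ := Nat.exists_eq_add_of_le' hh.1
      have := hμ k ⟨by lia, by have := hh.2; lia⟩
      exact dotProduct_lookaheadCov_succ_mulVec M hφ hπ hφ1 (by lia) v
  have := hμ h hh
  have hpsd := (hshift h hh).2.dotProduct_mulVec_nonneg v.ofLp
  rw [star_trivial, Matrix.sub_mulVec, Matrix.smul_mulVec, dotProduct_sub, dotProduct_smul,
    smul_eq_mul, dotProduct_featCov_mulVec M hφ hφ1, hlook] at hpsd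
  exact sub_nonneg.1 hpsd

end Covariance

end Matrices

section Rates

theorem ofReal_one_sub_le_of_measureReal_compl_le {Ω : Type*} [MeasurableSpace Ω] {Pr : Measure Ω}
    [IsProbabilityMeasure Pr] {s : Set Ω} {δ : ℝ} (hs : Pr.real sᶜ ≤ δ) :
    ENNReal.ofReal (1 - δ) ≤ Pr s := by
  have hcover : 1 ≤ Pr.real s + Pr.real sᶜ := by
    simpa using measureReal_union_le (μ := Pr) s sᶜ
  rw [← ofReal_measureReal]
  exact ENNReal.ofReal_le_ofReal (by linarith)

theorem failure_probability_le {d H δ : ℝ} (hδ : 0 < δ) (hd : 1 ≤ d) (hH : 1 ≤ H)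
    (h2 : 2 ≤ d * H / δ) : H * (6 * Real.exp (-(4 * Real.log (d * H / δ)))) ≤ δ := by
  have hpos : 0 < d * H / δ := by positivity
  set t := d * H / δ with ht
  have hexp : Real.exp (-(4 * Real.log t)) = t⁻¹ ^ 4 := by
    rw [Real.exp_neg, mul_comm, Real.exp_mul, Real.exp_log hpos, inv_pow]
    norm_cast
  have hcube : t⁻¹ ^ 3 ≤ 2⁻¹ ^ 3 := by gcongr
  have hHt : H * t⁻¹ ≤ δ := by
    rw [ht, inv_div, mul_div_assoc', div_le_iff₀ (by positivity), mul_comm H]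
    gcongr
    exact le_mul_of_one_le_left (by positivity) hd
  rw [hexp]
  calc H * (6 * t⁻¹ ^ 4) = 6 * (H * t⁻¹) * t⁻¹ ^ 3 := by ring
    _ ≤ 6 * δ * 2⁻¹ ^ 3 := by gcongr
    _ ≤ δ := by linarith

variable {C d N L : ℝ} {H : ℕ}

theorem sqrt_mul_deviation_le (hd : 0 ≤ d) (hN : 0 ≤ N) (hL : 0 ≤ L) :
    √d * √(2 * N * (4 * L)) ≤ 3 * √(d * L * N) := by
  rw [← Real.sqrt_mul hd]
  refine Real.sqrt_le_iff.2 ⟨by positivity, ?_⟩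
  rw [mul_pow, Real.sq_sqrt (by positivity)]
  have : 0 ≤ d * L * N := by positivity
  linarith

/-- The factor `H` in the regularization parameter is what keeps the inflation that accumulates over
`H` levels bounded. -/
theorem inflation_pow_le (hC : 0 < C) (hd : 1 ≤ d) (hH : 1 ≤ H) (hN : 0 < N) (hL : 0 < L) :
    (1 + 2 * (2 * √(2 * N * (4 * L))) / (C * H * √(d * L * N))) ^ H ≤ Real.exp (12 / C) := by
  have : (0 : ℝ) < H := by exact_mod_cast hH
  have : 0 < √(d * L * N) := by positivity
  have hdev : √(2 * N * (4 * L)) ≤ 3 * √(d * L * N) :=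
    (le_mul_of_one_le_left (Real.sqrt_nonneg _) (Real.one_le_sqrt.2 hd)).trans
      (sqrt_mul_deviation_le (by positivity) hN.le hL.le)
  calc _ ≤ (1 + 2 * (2 * (3 * √(d * L * N))) / (C * H * √(d * L * N))) ^ H := by gcongr
    _ = (12 / (C * H) + 1) ^ H := by congr 1; field_simp; ring
    _ ≤ Real.exp (12 / (C * H)) ^ H := by gcongr; exact Real.add_one_le_exp _
    _ = _ := by
        rw [← Real.exp_nat_mul]
        congr 1
        field_simp

theorem noise_term_le (hC : 0 < C) (hd : 1 ≤ d) (hH : 1 ≤ H) (hN : 0 < N) (hL : 0 < L) :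
    (1 + 2 * (H * √d)) * √(2 * N * (4 * L)) / √(C * H * √(d * L * N)) ≤
      9 / C * (√(C * H * √(d * L * N)) * (H * √d)) := by
  have hH1 : (1 : ℝ) ≤ H := by exact_mod_cast hH
  have hB : 1 ≤ H * √d := one_le_mul_of_one_le_of_one_le hH1 (Real.one_le_sqrt.2 hd)
  have hdev := sqrt_mul_deviation_le (d := d) (by positivity) hN.le hL.le
  set lam := C * H * √(d * L * N) with hlam
  have hlam0 : 0 < lam := by positivity
  rw [div_le_iff₀ (by positivity)]
  calc (1 + 2 * (H * √d)) * √(2 * N * (4 * L))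
      ≤ (3 * (H * √d)) * √(2 * N * (4 * L)) := by gcongr; linarith
    _ = 3 * H * (√d * √(2 * N * (4 * L))) := by ring
    _ ≤ 3 * H * (3 * √(d * L * N)) := by gcongr
    _ = 9 / C * lam := by rw [hlam]; field_simp; ring
    _ ≤ 9 / C * lam * (H * √d) := le_mul_of_one_le_right (by positivity) hB
    _ = _ := by linear_combination (-(9 / C * (H * √d))) * Real.sq_sqrt hlam0.le

theorem level_error_sq_le (hC : 0 < C) (hd : 1 ≤ d) (hH : 1 ≤ H) (hN : 0 < N) (hL : 0 < L) :
    (H * (√(C * H * √(d * L * N)) * (H * √d)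
      + (1 + 2 * (H * √d)) * √(2 * N * (4 * L)) / √(C * H * √(d * L * N)))) ^ 2 ≤
    N * (C * (1 + 9 / C) ^ 2 * (d * H ^ 5) * √(d * L / N)) := by
  have hnoise := noise_term_le hC hd hH hN hL
  have hσN : √(d * L * N) = N * √(d * L / N) := by
    rw [show d * L * N = N ^ 2 * (d * L / N) by field_simp, Real.sqrt_mul (by positivity),
      Real.sqrt_sq hN.le]
  set lam := C * H * √(d * L * N) with hlam
  have hlam0 : 0 ≤ lam := by positivity
  calc _ ≤ (H * (√lam * (H * √d) + 9 / C * (√lam * (H * √d)))) ^ 2 := by gcongr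
    _ = H ^ 4 * √d ^ 2 * √lam ^ 2 * (1 + 9 / C) ^ 2 := by ring
    _ = _ := by
        rw [Real.sq_sqrt (by positivity : 0 ≤ d), Real.sq_sqrt hlam0, hlam, hσN]
        ring

theorem error_bound_le (hC : 0 < C) (hd : 1 ≤ d) (hH : 1 ≤ H) (hN : 0 < N) (hL : 0 < L) {p : ℝ}
    (hp : 0 ≤ p) :
    p * (1 + 2 * (2 * √(2 * N * (4 * L))) / (C * H * √(d * L * N))) ^ H
      * (H * (√(C * H * √(d * L * N)) * (H * √d)
        + (1 + 2 * (H * √d)) * √(2 * N * (4 * L)) / √(C * H * √(d * L * N)))) ^ 2 ≤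
    N * (C * (1 + 9 / C) ^ 2 * Real.exp (12 / C) * p * (d * H ^ 5) * √(d * L / N)) :=
  calc _ ≤ p * Real.exp (12 / C) * (N * (C * (1 + 9 / C) ^ 2 * (d * H ^ 5) * √(d * L / N))) := by
        gcongr
        · exact inflation_pow_le hC hd hH hN hL
        · exact level_error_sq_le hC hd hH hN hL
    _ = _ := by ring

end Rates

end OfflineRL

theorem theorem3 (C : ℝ) (hC : 0 < C) :
    ∃ c : ℝ, 0 < c ∧
      ∀ (S : Type u) (A : Type v) (Ω : Type w)
        [MeasurableSpace S] [MeasurableSpace A] [MeasurableSpace Ω]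
        (Pr : Measure Ω) [IsProbabilityMeasure Pr]
        (M : OfflineRL.MDP S A) (d N : ℕ)
        -- the features and the policy to be evaluated
        (φ : S → A → EuclideanSpace ℝ (Fin d)) (π : S → A)
        -- the data distributions, the shift coefficients, the confidence and the datasets
        (μ : ℕ → Measure (S × A)) (Cs : ℕ → ℝ) (δ : ℝ)
        (D : ℕ → Fin N → Ω → OfflineRL.Sample S A),
        1 ≤ d → 1 ≤ N → 0 < δ → δ < 1 → 2 ≤ d * M.H / δ →
        Measurable (fun p : S × A => φ p.1 p.2) → Measurable π →
        (∀ s a, ‖φ s a‖ ≤ 1) →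
        (∀ h ∈ Set.Icc 1 M.H, IsProbabilityMeasure (μ h) ∧ ∀ᵐ p ∂(μ h), p.1 ∈ M.level h) →
        -- for each level, the samples are i.i.d.
        (∀ h ∈ Set.Icc 1 M.H,
          (∀ i, Measurable (D h i) ∧ Pr.map (D h i) = OfflineRL.sampleLaw M (μ h)) ∧
          iIndepFun (D h) Pr) →
        -- realizability for the policy
        (∀ h ∈ Set.Icc 1 M.H, ∃ θ : EuclideanSpace ℝ (Fin d), ‖θ‖ ≤ M.H * √d ∧
          ∀ s ∈ M.level h, ∀ a, M.Q π h s a = inner ℝ (φ s a) θ) →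
        -- low distribution shift
        (∀ h ∈ Set.Icc 1 M.H, 1 ≤ Cs h ∧
          (Cs h • OfflineRL.featCov φ (μ h) - OfflineRL.lookaheadCov M φ π μ h).PosSemidef) →
        ENNReal.ofReal (1 - δ) ≤
          Pr {ω | (M.Q π 1 M.s₁ (π M.s₁)
              - OfflineRL.QHat φ π (C * M.H * √(d * Real.log (d * M.H / δ) * N)) M.H
                  (fun h i => D h i ω) 1 M.s₁ (π M.s₁)) ^ 2
            ≤ c * (∏ h ∈ Finset.Icc 1 M.H, Cs h) * (d * (M.H : ℝ) ^ 5)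
                * √(d * Real.log (d * M.H / δ) / N)} := by
  refine ⟨C * (1 + 9 / C) ^ 2 * Real.exp (12 / C), by positivity, ?_⟩
  intro S A Ω _ _ _ Pr _ M d N φ π μ Cs δ D hd hN hδ _ h2 hφ hπ hφ1 hμ hD hreal hshift
  have hd1 : (1 : ℝ) ≤ d := by exact_mod_cast hd
  have hN0 : (0 : ℝ) < N := by exact_mod_cast hN
  have hH1 : (1 : ℝ) ≤ M.H := by exact_mod_cast M.H_pos
  have hCs : 0 ≤ ∏ h ∈ Finset.Icc 1 M.H, Cs h :=
    Finset.prod_nonneg fun h hh => zero_le_one.trans (hshift h (Finset.mem_Icc.1 hh)).1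
  have : Nonempty (Fin N) := Fin.pos_iff_nonempty.1 hN
  have hL : 0 < Real.log (d * M.H / δ) := Real.log_pos (by linarith)
  have hlam : 0 < C * M.H * √(d * Real.log (d * M.H / δ) * N) := by positivity
  have hfail := OfflineRL.measureReal_lt_card_mul_sq_error_le hφ hπ hφ1 hμ
    (fun h hh => ⟨fun i => ⟨((hD h hh).1 i).1.aemeasurable, ((hD h hh).1 i).2⟩, (hD h hh).2⟩)
    hreal (OfflineRL.hasBoundedShift_of_posSemidef M hφ hπ hφ1 (fun h hh => (hμ h hh).1) hshift)
    hlam (fun ω => OfflineRL.isLSPE_thetaHat φ π hlam M.H fun h i => D h i ω)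
    (x := 4 * Real.log (d * M.H / δ)) (by positivity)
  refine OfflineRL.ofReal_one_sub_le_of_measureReal_compl_le
    ((measureReal_mono fun ω hω => ?_).trans
      (hfail.trans (OfflineRL.failure_probability_le hδ hd1 hH1 h2)))
  rw [Set.mem_compl_iff, Set.mem_ofPred_eq, not_le] at hω
  rw [Set.mem_ofPred_eq, Fintype.card_fin]
  exact (OfflineRL.error_bound_le hC hd1 M.H_pos hN0 hL hCs).trans_lt (by gcongr; exact hω)
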